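/- **Conventions.** Let $\mathbb T=\mathbb R\cup\{\infty\}$ with $\oplus=\min$, $\odot=+$. "The minimum is attained twice" means that it is attained at two different indices or equals $\infty$. A *valuated matroid* $\mu$ of rank $k$ on a finite set $E$ is a vector $\mu\in\mathbb T^{\binom Ek}$, not identically $\infty$ and considered up to adding a real constant, such that for all $S\in\binom E{k-1}$, $T\in\binom E{k+1}$ the minimum of $\mu_{T\setminus i}+\mu_{S\cup i}$ over $i\in T\setminus S$ is attained twice. Its *bases* are the $J$ with $\mu_J\neq\infty$; its *tropical linear space* $L_\mu\subseteq\mathbb T^E$ consists of the $x$ such that for every $T\in\binom E{k+1}$ the minimum of $\mu_{T\setminus i}+x_i$ over $i\in T$ is attained twice. The *dual* of $\mu$ is $\mu^*_B=\mu_{E\setminus B}$, and $(\mu_1\oplus\mu_2)_{J_1\sqcup J_2}=(\mu_1)_{J_1}+(\mu_2)_{J_2}$. Let $[n]=\{1,\dots,n\}$ and $[2n]=\{1<\dots<n<\bar1<\dots<\bar n\}$, with $\bar{\bar i}=i$; for $\mu$ on $[n]$, the dual $\mu^*$ in $\mu\oplus\mu^*$ is placed on $\{\bar1,\dots,\bar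 n\}$. For a field $K$ with a valuation $v:K\to\mathbb T$, a valuated matroid $\mu$ of rank $k$ on $[n]$ is *realizable over $(K,v)$* if, up to a real constant, $\mu_J=v(X_J)$ for the maximal minors $X_J$ of a $k\times n$ matrix over $K$ of rank $k$. Let $S_{k,2n}(K)$ be the ideal of $K[X_J: J\in\binom{[2n]}k]$ generated by the Plücker relations $$\sum_{i\in T\setminus S}(-1)^{\#\{t\in T:\,t<i\}+\#\{s\in S:\,i<s\}}X_{T\setminus i}X_{S\cup i}\qquad\left(S\in\tbinom{[2n]}{k-1},\ T\in\tbinom{[2n]}{k+1}\right)$$ and the symplectic relations $$\sum_{i\in[n],\ i,\bar i\notin S}(-1)^{\#\{s\in S:\,i<s\}+\#\{s\in S:\,\bar i<s\}}X_{S\cup\{i,\bar i\}}\qquad\left(S\in\tbinom{[2n]}{k-2}\right).$$ Let $\mathrm{TSpGr}_{(K,v)}(k,2n)$ be the set of $w\in\mathbb T^{\binom{[2n]}k}$, not identically $\infty$, such that for every $f=\sum_a c_aX^a\in S_{k,2n}(K)$ the minimum of $v(c_a)+\sum_J a_Jw_J$ over the monomials of $f$ is attained twice. For algebraically closed $K$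 of characteristic $p$ with $v$ trivial on the prime field, this set depends on $p$ only and is denoted $\mathrm{TSpGr}_p(k,2n)$. A vector on $\binom{[2n]}k$ *satisfies the tropical symplectic relations* if for every $S\in\binom{[2n]}{k-2}$ the minimum of $\mu_{S\cup\{i,\bar i\}}$ over $i\in[n]$ with $i,\bar i\notin S$ is attained twice; $\mathrm{SpDr}(k,2n)$ is the set of valuated matroids of rank $k$ on $[2n]$ that satisfy them. A set $L\subseteq\mathbb T^{2n}$ is *isotropic* if for all $x,y\in L$ the minimum of $x_i+y_{\bar i}$ over $i\in[2n]$ is attained twice. A matrix $A\in\mathbb T^{k\times E}$ is a *presentation* of a valuated matroid $\mu$ of rank $k$ on $E$ if, up to a real constant, $\mu_J$ is the tropical determinant $\min_\sigma\sum_iA_{i\sigma(i)}$ (over bijections $\sigma:[k]\to J$) for all $J\in\binom Ek$; $\mu$ is *transversal* if it has a presentation. A presentation $(A\,|\,B)$ of a valuated matroid on $[2n]$, with $A,B\in\mathbb T^{k\times n}$, is *symmetric* if the matrix $A\odot B^T$ is symmetric. **Theorem.** Let $\mu$ be a valuated matroid on $[n]$. 1. If $\mu$ is realizable over a field $K$ of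 characteristic $p$ with valuation $v$, then $\mu\oplus\mu^*\in\mathrm{TSpGr}_{(K,v)}(n,2n)$; if moreover $v$ is trivial on the prime field (which is automatic for $p>0$), then $\mu\oplus\mu^*\in\mathrm{TSpGr}_p(n,2n)$. 2. $\mu\oplus\mu^*\in\mathrm{SpDr}(n,2n)$; that is, $\mu\oplus\mu^*$ is a valuated matroid that satisfies the tropical symplectic relations. 3. The conormal bundle $L_{\mu\oplus\mu^*}$ is isotropic. 4. If $\mu$ and $\mu^*$ are transversal, then $\mu\oplus\mu^*$ has a symmetric presentation if and only if $\mu$ has exactly one basis. -/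

import Mathlib

/-! Tropical numbers are `WithTop ℝ` with tropical sum `min` and tropical product `+`.  A vector
of `𝕋^(E choose k)` is given as a function on all finite subsets of `E` with the value `∞` on the
subsets whose cardinality is not `k`. -/

universe u w

/-- The tropical semifield `ℝ ∪ {∞}`. -/
abbrev TropNum : Type := WithTop ℝ

/-- The minimum of `f` over `s` is achieved at least twice, or is equal to `∞`. -/
def MinTwice {ι : Type*} (s : Finset ι) (f : ι → TropNum) : Prop :=
  s.inf f = ⊤ ∨ ∃ i ∈ s, ∃ j ∈ s, i ≠ j ∧ f i = s.inf f ∧ f j = s.inf f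

/-- `μ` is a vector of `𝕋^(E choose k)` that is not identically `∞`, that is, it represents a
point of the tropical projective space. -/
def IsTropProjVector {E : Type*} (k : ℕ) (μ : Finset E → TropNum) : Prop :=
  (∀ J : Finset E, J.card ≠ k → μ J = ⊤) ∧ ∃ J : Finset E, μ J ≠ ⊤

/-- Valuated matroids (tropical Plücker vectors) of rank `k` on `E`: the Dressian. -/
def IsValuatedMatroid {E : Type*} [DecidableEq E] (k : ℕ) (μ : Finset E → TropNum) : Prop :=
  IsTropProjVector k μ ∧
    ∀ S T : Finset E, S.card + 1 = k → T.card = k + 1 →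
      MinTwice (T \ S) fun i => μ (T.erase i) + μ (insert i S)

/-- The dual valuated matroid. -/
def dualVM {E : Type*} [Fintype E] [DecidableEq E] (μ : Finset E → TropNum) : Finset E → TropNum :=
  fun B => μ Bᶜ

/-- The direct sum of two valuated matroids, on the disjoint union of the ground sets. -/
def directSumVM {E₁ E₂ : Type*} (μ₁ : Finset E₁ → TropNum) (μ₂ : Finset E₂ → TropNum) :
    Finset (E₁ ⊕ E₂) → TropNum :=
  fun J => μ₁ J.toLeft + μ₂ J.toRight

/-- The tropical linear space of a valuated matroid of rank `k`. -/
def tropLinearSpace {E : Type*} [DecidableEq E] (k : ℕ) (μ : Finset E → TropNum) : Set (E → TropNum) :=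
  {x | ∀ T : Finset E, T.card = k + 1 → MinTwice T fun i => μ (T.erase i) + x i}

/-- The conormal bundle of `μ`.  The ground set `[2n] = {1, …, n, 1̄, …, n̄}` is
`Fin n ⊕ Fin n`, and `Sum.swap` is the bar involution. -/
def conormalBundle {n : ℕ} (μ : Finset (Fin n) → TropNum) : Set (Fin n ⊕ Fin n → TropNum) :=
  tropLinearSpace n (directSumVM μ (dualVM μ))

/-- Tropical orthogonality of two points of `𝕋^(2n)`. -/
def TropOrthogonal {n : ℕ} (x y : Fin n ⊕ Fin n → TropNum) : Prop :=
  MinTwice Finset.univ fun i => x i + y i.swap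

/-- A set of points is isotropic if its points are pairwise orthogonal. -/
def TropIsotropic {n : ℕ} (L : Set (Fin n ⊕ Fin n → TropNum)) : Prop :=
  ∀ x ∈ L, ∀ y ∈ L, TropOrthogonal x y

/-- The tropical symplectic relations for a vector of `𝕋^([2n] choose k)`. -/
def TropSymplecticRelations (k n : ℕ) (μ : Finset (Fin n ⊕ Fin n) → TropNum) : Prop :=
  ∀ S : Finset (Fin n ⊕ Fin n), S.card + 2 = k →
    MinTwice (Finset.univ.filter fun i : Fin n => Sum.inl i ∉ S ∧ Sum.inr i ∉ S)
      fun i => μ (insert (Sum.inl i) (insert (Sum.inr i) S))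

/-- The symplectic Dressian. -/
def symplecticDressian (k n : ℕ) : Set (Finset (Fin n ⊕ Fin n) → TropNum) :=
  {μ | IsValuatedMatroid k μ ∧ TropSymplecticRelations k n μ}

/-! ### The Stiefel map -/

/-- The tropical Stiefel map: `stiefel A J` is the tropical determinant of the submatrix of `A`
with the columns in `J` (and `∞` if `J` does not have `k` elements, as there is then no bijection
from the rows to `J`). -/
noncomputable def stiefel {E : Type*} [DecidableEq E] {k : ℕ} (A : Matrix (Fin k) E TropNum) :
    Finset E → TropNum :=
  fun J => (Finset.univ : Finset (Fin k ≃ {x // x ∈ J})).inf fun σ => ∑ i, A i (σ i)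

/-- `A` is a presentation of `μ`: `π(A) = μ` in tropical projective space, that is, up to adding
a real constant. -/
def IsPresentation {E : Type*} [DecidableEq E] {k : ℕ} (A : Matrix (Fin k) E TropNum)
    (μ : Finset E → TropNum) : Prop :=
  ∃ c : ℝ, ∀ J, μ J = stiefel A J + (c : TropNum)

/-- Transversal valuated matroids of rank `k`. -/
def IsTransversalVM {E : Type*} [DecidableEq E] (k : ℕ) (μ : Finset E → TropNum) : Prop :=
  ∃ A : Matrix (Fin k) E TropNum, IsPresentation A μ

/-- The tropical matrix product `A ⊙ Bᵀ`. -/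
def tropMulTranspose {k n : ℕ} (A B : Matrix (Fin k) (Fin n) TropNum) :
    Matrix (Fin k) (Fin k) TropNum :=
  Matrix.of fun i j => Finset.univ.inf fun l => A i l + B j l

/-- `μ` has a presentation `(A | B)` with `A ⊙ Bᵀ` symmetric. -/
def HasSymmetricPresentation {n : ℕ} (k : ℕ) (μ : Finset (Fin n ⊕ Fin n) → TropNum) : Prop :=
  ∃ A B : Matrix (Fin k) (Fin n) TropNum,
    IsPresentation (Matrix.fromCols A B) μ ∧ (tropMulTranspose A B).IsSymm

/-! ### Realizability and the tropical symplectic Grassmannian -/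

/-- `μ` is realizable over the field `K` with valuation `v`: up to adding a real constant it is
the coordinatewise valuation of the vector of maximal minors of a matrix whose (independent) rows
span a `k`-dimensional subspace of `K^n`. -/
def IsRealizableVM {K : Type*} [Field K] (v : AddValuation K TropNum) {n : ℕ} (k : ℕ)
    (μ : Finset (Fin n) → TropNum) : Prop :=
  ∃ M : Matrix (Fin k) (Fin n) K, LinearIndependent K M.row ∧
    ∃ c : ℝ, ∀ (J : Finset (Fin n)) (hJ : J.card = k),
      μ J = v (M.submatrix id (J.orderEmbOfFin hJ)).det + (c : TropNum)

/-- The Plücker coordinate `X_J` as a variable, for `J` with `k` elements. -/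
noncomputable def pluckerVar (K : Type*) [Field K] {E : Type*} (k : ℕ) (J : Finset E) :
    MvPolynomial {J : Finset E // J.card = k} K :=
  if h : J.card = k then MvPolynomial.X ⟨J, h⟩ else 0

/-- The quadratic Plücker relation of `S`, `T` (with `|S| = k - 1` and `|T| = k + 1`) on
`[2n]`, ordered by `1 < ⋯ < n < 1̄ < ⋯ < n̄`.  The sign of the term of `i` is that of the place of
`i` in `T`, times the sign of the permutation that sorts `S` followed by `i`. -/
noncomputable def pluckerRelation (K : Type*) [Field K] (k n : ℕ)
    (S T : Finset (Fin n ⊕ Fin n)) :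
    MvPolynomial {J : Finset (Fin n ⊕ Fin n) // J.card = k} K :=
  ∑ i ∈ T \ S,
    (-1) ^ ((T.filter fun t => toLex t < toLex i).card + (S.filter fun s => toLex i < toLex s).card)
      * (pluckerVar K k (T.erase i) * pluckerVar K k (insert i S))

/-- The linear symplectic relation `∑ X_{S i ī}` of `S` (with `|S| = k - 2`), where `X` is
alternating in its indices: the sign is that of the permutation that sorts `S` followed by
`i`, `ī`. -/
noncomputable def symplecticRelation (K : Type*) [Field K] (k n : ℕ)
    (S : Finset (Fin n ⊕ Fin n)) :
    MvPolynomial {J : Finset (Fin n ⊕ Fin n) // J.card = k} K :=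
  ∑ i ∈ Finset.univ.filter fun i : Fin n => Sum.inl i ∉ S ∧ Sum.inr i ∉ S,
    (-1) ^ ((S.filter fun s => toLex (Sum.inl i) < toLex s).card +
        (S.filter fun s => toLex (Sum.inr i) < toLex s).card)
      * pluckerVar K k (insert (Sum.inl i) (insert (Sum.inr i) S))

/-- The Plücker–symplectic ideal. -/
noncomputable def pluckerSymplecticIdeal (K : Type*) [Field K] (k n : ℕ) :
    Ideal (MvPolynomial {J : Finset (Fin n ⊕ Fin n) // J.card = k} K) :=
  Ideal.span
    ({f | ∃ S T : Finset (Fin n ⊕ Fin n), S.card + 1 = k ∧ T.card = k + 1 ∧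
        f = pluckerRelation K k n S T} ∪
      {f | ∃ S : Finset (Fin n ⊕ Fin n), S.card + 2 = k ∧ f = symplecticRelation K k n S})

/-- `w` lies on the tropical hypersurface of `f`. -/
def InTropHypersurface {K : Type*} [Field K] (v : AddValuation K TropNum) {σ : Type*}
    (f : MvPolynomial σ K) (w : σ → TropNum) : Prop :=
  MinTwice f.support fun a => v (f.coeff a) + a.sum fun s m => m • w s

/-- The tropicalization of the symplectic Grassmannian over the valued field `(K, v)`. -/
def tropSymplecticGrOver {K : Type*} [Field K] (v : AddValuation K TropNum) (k n : ℕ) :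
    Set (Finset (Fin n ⊕ Fin n) → TropNum) :=
  {w | IsTropProjVector k w ∧
    ∀ f ∈ pluckerSymplecticIdeal K k n, InTropHypersurface v f fun J => w J.1}

/-- The valuation is trivial on the prime field: every integer that is nonzero in `K` has
valuation `0`.  (Automatic in positive characteristic.) -/
def TrivialOnPrimeField {K : Type*} [Field K] (v : AddValuation K TropNum) : Prop :=
  ∀ m : ℤ, (m : K) ≠ 0 → v (m : K) = 0

/-- The tropical symplectic Grassmannian in characteristic `p`: the vectors that lie in the
tropicalization of the symplectic Grassmannian over algebraically closed valued fields of
characteristic `p`.  In mixed characteristic the tropicalization also depends on the residue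
characteristic, so the valuations here are those that are trivial on the prime field; for them it
depends on `p` only. -/
def tropSymplecticGr (p k n : ℕ) : Set (Finset (Fin n ⊕ Fin n) → TropNum) :=
  {w | ∀ (K : Type u) [Field K] [CharP K p] [IsAlgClosed K] (v : AddValuation K TropNum),
    TrivialOnPrimeField v → w ∈ tropSymplecticGrOver v k n}

/-! The condition on minima is used in a local form, `minTwice_iff`: every finite term is matched by
a term at another index that is no larger.

Symplectic relations. Split `S` into its halves S₁ and S₂. The term of `i` is μ(S₁ ∪ i) + μ(S₂ᶜ \
i), so the symplectic relation of `S` is the Plücker relation of `μ` for the pair (S₁, S₂ᶜ).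

Isotropy. The two halves of a point of the conormal bundle lie in the tropical linear spaces of `μ`
and of its dual, so it suffices that these two spaces are orthogonal. At any finite coordinate a
point of the dual space touches a multiple of a cocircuit that bounds it from above
(`exists_cocircuit_le`). A cocircuit of the dual is a circuit of `μ`, and circuits are what cut out
the linear space of `μ`.

Symmetric presentations. Only the finite entries of (A | B) matter. The images of the matchings of
all rows along finite entries are the bases of μ ⊕ μ*, so each matching meets the left half in
exactly `k` columns. If `μ` had two bases, symmetry would give a row joined to both halves along
which a matching could be rerouted to a different number of left columns
(`false_of_balanced_matchings`). If there is one basis, two diagonal matrices with complementary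
supports do.

Realizations. Let M realize `μ` and let the rows of M' span the orthogonal complement of the row
space of M (`exists_dual_matrix`). The rows of diag(M, M') are isotropic for the symplectic form, so
its minors satisfy the Plücker and the symplectic relations exactly. Each minor is zero or, up to
sign, a product of a minor of M and a minor of M', and the latter is a complementary minor of M up
to sign and a common factor. Hence the minors have valuation μ ⊕ μ* up to a constant. Finally, the
ideal is defined over the prime field, and where the valuation is trivial on it, membership can be
tested there (`mem_tropSymplecticGrOver_of_common_subfield`). -/

/-! ### Duals, direct sums and the tropical symplectic relations. -/

theorem minTwice_iff {ι : Type*} (s : Finset ι) (f : ι → TropNum) :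
    MinTwice s f ↔ ∀ i ∈ s, f i ≠ ⊤ → ∃ j ∈ s, j ≠ i ∧ f j ≤ f i := by
  constructor
  · rintro (h | ⟨a, ha, b, hb, hab, ha', hb'⟩) i hi hne
    · exact absurd ((Finset.inf_eq_top_iff f s).1 h i hi) hne
    · by_cases hai : a = i
      · exact ⟨b, hb, fun h => hab (hai.trans h.symm), hb'.trans_le (Finset.inf_le hi)⟩
      · exact ⟨a, ha, hai, ha'.trans_le (Finset.inf_le hi)⟩
  · intro h
    by_cases htop : s.inf f = ⊤
    · exact Or.inl htop
    · have hs : s.Nonempty := by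
        rw [Finset.nonempty_iff_ne_empty]
        rintro rfl
        exact htop rfl
      obtain ⟨i, hi, hif⟩ := Finset.exists_mem_eq_inf s hs f
      obtain ⟨j, hj, hji, hle⟩ := h i hi (hif ▸ htop)
      exact Or.inr ⟨i, hi, j, hj, hji.symm, hif.symm,
        le_antisymm (hle.trans hif.ge) (Finset.inf_le hj)⟩

theorem IsTropProjVector.card_eq {E : Type*} {k : ℕ} {μ : Finset E → TropNum}
    (h : IsTropProjVector k μ) {J : Finset E} (hJ : μ J ≠ ⊤) : J.card = k := by
  by_contra hc
  exact hJ (h.1 J hc)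

theorem IsTropProjVector.dual {n k : ℕ} {μ : Finset (Fin n) → TropNum}
    (h : IsTropProjVector k μ) : IsTropProjVector (n - k) (dualVM μ) := by
  have key : ∀ J : Finset (Fin n), μ Jᶜ ≠ ⊤ → J.card = n - k := by
    intro J hJ
    have h1 := h.card_eq hJ
    have h2 := Finset.card_add_card_compl J
    simp only [Fintype.card_fin] at h2
    omega
  refine ⟨fun J hJ => ?_, ?_⟩
  · by_contra hc
    exact hJ (key J hc)
  · obtain ⟨J, hJ⟩ := h.2
    exact ⟨Jᶜ, by simpa [dualVM] using hJ⟩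

theorem IsTropProjVector.rank_le {n k : ℕ} {μ : Finset (Fin n) → TropNum}
    (h : IsTropProjVector k μ) : k ≤ n := by
  obtain ⟨J, hJ⟩ := h.2
  simpa [h.card_eq hJ] using J.card_le_univ

theorem IsValuatedMatroid.dual {n k : ℕ} {μ : Finset (Fin n) → TropNum}
    (h : IsValuatedMatroid k μ) : IsValuatedMatroid (n - k) (dualVM μ) := by
  refine ⟨h.1.dual, fun S T hS hT => ?_⟩
  have hk := h.1.rank_le
  have hSc := Finset.card_add_card_compl S
  have hTc := Finset.card_add_card_compl T
  simp only [Fintype.card_fin] at hSc hTc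
  have := h.2 Tᶜ Sᶜ (by omega) (by omega)
  have hset : Sᶜ \ Tᶜ = T \ S := by
    ext i; simp [and_comm]
  rw [hset] at this
  convert this using 2 with i
  simp only [dualVM, Finset.compl_erase, Finset.compl_insert]
  rw [add_comm]

theorem directSumVM_ne_top {E₁ E₂ : Type*} {μ₁ : Finset E₁ → TropNum} {μ₂ : Finset E₂ → TropNum}
    {J : Finset (E₁ ⊕ E₂)} : directSumVM μ₁ μ₂ J ≠ ⊤ ↔ μ₁ J.toLeft ≠ ⊤ ∧ μ₂ J.toRight ≠ ⊤ := by
  simp [directSumVM, not_or]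

theorem Finset.toLeft_erase_inl {E₁ E₂ : Type*} [DecidableEq E₁] [DecidableEq E₂] (a : E₁)
    (J : Finset (E₁ ⊕ E₂)) : (J.erase (Sum.inl a)).toLeft = J.toLeft.erase a := by ext; simp

theorem Finset.toRight_erase_inl {E₁ E₂ : Type*} [DecidableEq E₁] [DecidableEq E₂] (a : E₁)
    (J : Finset (E₁ ⊕ E₂)) : (J.erase (Sum.inl a)).toRight = J.toRight := by ext; simp

theorem Finset.toLeft_erase_inr {E₁ E₂ : Type*} [DecidableEq E₁] [DecidableEq E₂] (a : E₂)
    (J : Finset (E₁ ⊕ E₂)) : (J.erase (Sum.inr a)).toLeft = J.toLeft := by ext; simp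

theorem Finset.toRight_erase_inr {E₁ E₂ : Type*} [DecidableEq E₁] [DecidableEq E₂] (a : E₂)
    (J : Finset (E₁ ⊕ E₂)) : (J.erase (Sum.inr a)).toRight = J.toRight.erase a := by ext; simp

theorem IsTropProjVector.directSum {E₁ E₂ : Type*} [DecidableEq E₁] [DecidableEq E₂] {k₁ k₂ : ℕ}
    {μ₁ : Finset E₁ → TropNum} {μ₂ : Finset E₂ → TropNum} (h₁ : IsTropProjVector k₁ μ₁)
    (h₂ : IsTropProjVector k₂ μ₂) : IsTropProjVector (k₁ + k₂) (directSumVM μ₁ μ₂) := by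
  refine ⟨fun J hJ => ?_, ?_⟩
  · by_contra hc
    obtain ⟨h1, h2⟩ := directSumVM_ne_top.1 hc
    apply hJ
    rw [← h₁.card_eq h1, ← h₂.card_eq h2, Finset.card_toLeft_add_card_toRight]
  · obtain ⟨J₁, hJ₁⟩ := h₁.2
    obtain ⟨J₂, hJ₂⟩ := h₂.2
    exact ⟨J₁.disjSum J₂, directSumVM_ne_top.2 (by simpa using ⟨hJ₁, hJ₂⟩)⟩

/-- A finite term at an element of one summand forces `S` and `T` to have, within that summand, the
sizes of a Plücker relation. That relation supplies the second term, since the contribution of the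
other summand is unchanged. -/
theorem IsValuatedMatroid.directSum {E₁ E₂ : Type*} [DecidableEq E₁] [DecidableEq E₂] {k₁ k₂ : ℕ}
    {μ₁ : Finset E₁ → TropNum} {μ₂ : Finset E₂ → TropNum} (h₁ : IsValuatedMatroid k₁ μ₁)
    (h₂ : IsValuatedMatroid k₂ μ₂) : IsValuatedMatroid (k₁ + k₂) (directSumVM μ₁ μ₂) := by
  refine ⟨h₁.1.directSum h₂.1, fun S T _ _ => (minTwice_iff _ _).2 ?_⟩
  rintro (a | a) ha hne
  · simp only [directSumVM, Finset.toLeft_erase_inl, Finset.toRight_erase_inl,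
      Finset.toLeft_insert_inl, Finset.toRight_insert_inl] at hne ⊢
    have haTS : a ∈ T.toLeft \ S.toLeft := by simpa using ha
    obtain ⟨haT, haS⟩ := Finset.mem_sdiff.1 haTS
    simp only [ne_eq, WithTop.add_eq_top, not_or] at hne
    obtain ⟨⟨n1, n2⟩, n3, n4⟩ := hne
    have c1 := h₁.1.card_eq n1
    have c3 := h₁.1.card_eq n3
    rw [Finset.card_insert_of_notMem haS] at c3
    rw [Finset.card_erase_of_mem haT] at c1
    have := Finset.card_pos.2 ⟨a, haT⟩
    obtain ⟨b, hb, hba, hle⟩ := (minTwice_iff _ _).1 (h₁.2 S.toLeft T.toLeft c3 (by omega)) a haTS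
      (by simp [n1, n3])
    refine ⟨Sum.inl b, by simpa using hb, by simpa using hba, ?_⟩
    simp only [Finset.toLeft_erase_inl, Finset.toRight_erase_inl,
      Finset.toLeft_insert_inl, Finset.toRight_insert_inl]
    rw [add_add_add_comm, add_add_add_comm (μ₁ (T.toLeft.erase a))]
    gcongr
  · simp only [directSumVM, Finset.toLeft_erase_inr, Finset.toRight_erase_inr,
      Finset.toLeft_insert_inr, Finset.toRight_insert_inr] at hne ⊢
    have haTS : a ∈ T.toRight \ S.toRight := by simpa using ha
    obtain ⟨haT, haS⟩ := Finset.mem_sdiff.1 haTS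
    simp only [ne_eq, WithTop.add_eq_top, not_or] at hne
    obtain ⟨⟨n1, n2⟩, n3, n4⟩ := hne
    have c1 := h₂.1.card_eq n2
    have c3 := h₂.1.card_eq n4
    rw [Finset.card_insert_of_notMem haS] at c3
    rw [Finset.card_erase_of_mem haT] at c1
    have := Finset.card_pos.2 ⟨a, haT⟩
    obtain ⟨b, hb, hba, hle⟩ := (minTwice_iff _ _).1 (h₂.2 S.toRight T.toRight c3 (by omega)) a haTS
      (by simp [n2, n4])
    refine ⟨Sum.inr b, by simpa using hb, by simpa using hba, ?_⟩
    simp only [Finset.toLeft_erase_inr, Finset.toRight_erase_inr,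
      Finset.toLeft_insert_inr, Finset.toRight_insert_inr]
    rw [add_add_add_comm, add_add_add_comm (μ₁ T.toLeft) (μ₂ (T.toRight.erase a))]
    gcongr

theorem directSumVM_dualVM_mem_symplecticDressian {n k : ℕ} {μ : Finset (Fin n) → TropNum}
    (h : IsValuatedMatroid k μ) : directSumVM μ (dualVM μ) ∈ symplecticDressian n n := by
  have hk := h.1.rank_le
  constructor
  · have := h.directSum h.dual
    rwa [Nat.add_sub_cancel' hk] at this
  · intro S _
    refine (minTwice_iff _ _).2 fun i hi hne => ?_
    simp only [directSumVM, dualVM, Finset.toLeft_insert_inl, Finset.toLeft_insert_inr,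
      Finset.toRight_insert_inl, Finset.toRight_insert_inr, Finset.compl_insert, Finset.mem_filter,
      Finset.mem_univ, true_and] at hi hne ⊢
    have hiS : i ∉ S.toLeft := by simpa using hi.1
    have hiT : i ∈ S.toRightᶜ := by simpa using hi.2
    simp only [ne_eq, WithTop.add_eq_top, not_or] at hne
    -- Finiteness of the term of `i` makes both S₁ ∪ i and S₂ᶜ \ i bases, so that S₁ and S₂ᶜ have
    -- sizes `k - 1` and `k + 1`.
    have c1 := h.1.card_eq hne.1
    have c2 := h.1.card_eq hne.2
    rw [Finset.card_insert_of_notMem hiS] at c1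
    rw [Finset.card_erase_of_mem hiT] at c2
    have := Finset.card_pos.2 ⟨i, hiT⟩
    obtain ⟨j, hj, hji, hle⟩ := (minTwice_iff _ _).1 (h.2 S.toLeft S.toRightᶜ c1 (by omega)) i
      (by simp [hi.1, hi.2]) (by simp [hne])
    refine ⟨j, ?_, hji, ?_⟩
    · simpa [and_comm] using hj
    · rw [add_comm, add_comm (μ (insert i _))]
      exact hle

/-! ### Isotropy of the conormal bundle. -/

/-- Every point of a tropical linear space is a tropical combination of cocircuits. -/
theorem exists_cocircuit_le {E : Type*} [Fintype E] [DecidableEq E] {k : ℕ}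
    {ν : Finset E → TropNum} (hν : IsTropProjVector k ν) {y : E → TropNum}
    (hy : y ∈ tropLinearSpace k ν) {i : E} (hi : y i ≠ ⊤) :
    ∃ S : Finset E, i ∉ S ∧ ν (insert i S) ≠ ⊤ ∧
      ∀ j ∉ S, y j + ν (insert i S) ≤ y i + ν (insert j S) := by
  classical
  let Z : Finset E := Finset.univ.filter fun j => y j = ⊤
  -- This is the weight ν(B) - y(B), where an infinite coordinate of `y` outweighs everything real:
  -- first minimize the number of elements with finite `y`, then the real part. The default value 0
  -- is never used on bases.
  let g : Finset E → ℕ ×ₗ ℝ := fun B =>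
    toLex ((B \ Z).card, (ν B).untopD 0 - ∑ b ∈ B \ Z, (y b).untopD 0)
  obtain ⟨B₀, hB₀⟩ := hν.2
  obtain ⟨B, hB, hmin⟩ := Finset.exists_min_image (Finset.univ.filter fun B => ν B ≠ ⊤) g
    ⟨B₀, by simpa using hB₀⟩
  replace hB : ν B ≠ ⊤ := by simpa using hB
  replace hmin : ∀ B', ν B' ≠ ⊤ → g B ≤ g B' := fun B' h => hmin B' (by simpa using h)
  have hiZ : i ∉ Z := by simpa [Z] using hi
  -- an exchange of elements outside `Z`
  have hg : ∀ (S : Finset E) (a b : E), a ∉ S → b ∉ S → a ∉ Z → b ∉ Z → ν (insert a S) ≠ ⊤ →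
      ν (insert b S) ≠ ⊤ → (g (insert a S) ≤ g (insert b S) ↔
        y b + ν (insert a S) ≤ y a + ν (insert b S)) := by
    intro S a b ha hb haZ hbZ hνa hνb
    have e1 : ∀ c : E, c ∉ Z → insert c S \ Z = insert c (S \ Z) := fun c hc => by
      rw [Finset.insert_sdiff_of_notMem _ hc]
    have hya : y a ≠ ⊤ := by simpa [Z] using haZ
    have hyb : y b ≠ ⊤ := by simpa [Z] using hbZ
    have ha' : a ∉ S \ Z := by simp [ha]
    have hb' : b ∉ S \ Z := by simp [hb]
    simp only [g, e1 a haZ, e1 b hbZ, Finset.card_insert_of_notMem ha',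
      Finset.card_insert_of_notMem hb', Finset.sum_insert ha', Finset.sum_insert hb',
      Prod.Lex.toLex_le_toLex, lt_irrefl, false_or, true_and]
    lift ν (insert a S) to ℝ using hνa with na
    lift ν (insert b S) to ℝ using hνb with nb
    lift y a to ℝ using hya with xa
    lift y b to ℝ using hyb with xb
    simp only [WithTop.untopD_coe]
    norm_cast
    constructor <;> intro <;> linarith
  -- If a minimizer omits `i`, the circuit condition on B ∪ i exchanges some `j` for `i` without
  -- increasing the weight. The required `S` is then the minimizer without `i`.
  have key : ∃ B, i ∈ B ∧ ν B ≠ ⊤ ∧ ∀ B', ν B' ≠ ⊤ → g B ≤ g B' := by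
    by_cases hiB : i ∈ B
    · exact ⟨B, hiB, hB, hmin⟩
    have hcard : (insert i B).card = k + 1 := by
      rw [Finset.card_insert_of_notMem hiB, hν.card_eq hB]
    obtain ⟨j, hj, hji, hle⟩ := (minTwice_iff _ _).1 (hy _ hcard) i (Finset.mem_insert_self i B)
      (by simp [Finset.erase_insert hiB, hB, hi])
    have hjB : j ∈ B := (Finset.mem_insert.1 hj).resolve_left hji
    rw [Finset.erase_insert hiB] at hle
    have hne : ν ((insert i B).erase j) + y j ≠ ⊤ :=
      ne_top_of_le_ne_top (by simp [hB, hi]) hle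
    rw [Ne, WithTop.add_eq_top, not_or] at hne
    have hjZ : j ∉ Z := by simpa [Z] using hne.2
    have e1 : (insert i B).erase j = insert i (B.erase j) := by
      rw [Finset.erase_insert_of_ne hji.symm]
    refine ⟨(insert i B).erase j, by simp [hji.symm], hne.1, fun B' hB' => le_trans ?_ (hmin B' hB')⟩
    rw [e1] at hle hne ⊢
    have := (hg (B.erase j) i j (by simp [hiB]) (by simp) hiZ hjZ hne.1
      (by rwa [Finset.insert_erase hjB])).2
    rw [Finset.insert_erase hjB] at this
    apply this
    rwa [add_comm, add_comm (y i)]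
  obtain ⟨B, hiB, hB, hmin⟩ := key
  refine ⟨B.erase i, by simp, by rwa [Finset.insert_erase hiB], fun j hj => ?_⟩
  rw [Finset.insert_erase hiB]
  by_cases hνj : ν (insert j (B.erase i)) = ⊤
  · simp [hνj]
  have h1 := hmin _ hνj
  by_cases hjZ : j ∈ Z
  -- Exchanging `i` for an element of `Z` would lower the first component of the weight.
  · exfalso
    simp only [g, Finset.insert_sdiff_of_mem _ hjZ, Prod.Lex.toLex_le_toLex] at h1
    have h2 : (B.erase i \ Z).card < (B \ Z).card := by
      apply Finset.card_lt_card
      refine (Finset.ssubset_iff_of_subset (Finset.sdiff_subset_sdiff (Finset.erase_subset _ _) le_rfl)).2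
        ⟨i, by simp [hiB, hiZ], by simp⟩
    omega
  · have := (hg (B.erase i) i j (by simp) hj hiZ hjZ (by rwa [Finset.insert_erase hiB]) hνj).1
    rw [Finset.insert_erase hiB] at this
    exact this h1

/-- With T = Sᶜ for the cocircuit at `i`, the condition of `x` on `T` yields a `j` with μ(T \ j) +
x_j ≤ μ(T \ i) + x_i. Adding the cocircuit bound y_j + μ(T \ i) ≤ y_i + μ(T \ j) and cancelling
gives the second index. -/
theorem minTwice_add_of_mem_tropLinearSpace_dual {n k : ℕ} {μ : Finset (Fin n) → TropNum}
    (hμ : IsTropProjVector k μ) {x y : Fin n → TropNum} (hx : x ∈ tropLinearSpace k μ)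
    (hy : y ∈ tropLinearSpace (n - k) (dualVM μ)) : MinTwice Finset.univ fun i => x i + y i := by
  refine (minTwice_iff _ _).2 fun i _ hne => ?_
  rw [Ne, WithTop.add_eq_top, not_or] at hne
  obtain ⟨S, hiS, hS, hle⟩ := exists_cocircuit_le hμ.dual hy hne.2
  have hcard : Sᶜ.card = k + 1 := by
    have h1 := hμ.dual.card_eq hS
    have h2 := hμ.card_eq (J := (insert i S)ᶜ) hS
    rw [Finset.compl_insert, Finset.card_erase_of_mem (by simpa using hiS)] at h2
    have := Finset.card_pos.2 ⟨i, Finset.mem_compl.2 hiS⟩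
    omega
  simp only [dualVM, Finset.compl_insert] at hS hle
  obtain ⟨j, hj, hji, hle'⟩ := (minTwice_iff _ _).1 (hx _ hcard) i (by simpa using hiS)
    (by simp [hS, hne.1])
  refine ⟨j, Finset.mem_univ _, hji, ?_⟩
  have h3 := hle j (by simpa using hj)
  have : x j + y j + μ (Sᶜ.erase i) ≤ x i + y i + μ (Sᶜ.erase i) :=
    calc x j + y j + μ (Sᶜ.erase i) = x j + (y j + μ (Sᶜ.erase i)) := add_assoc _ _ _
      _ ≤ x j + (y i + μ (Sᶜ.erase j)) := by gcongr
      _ = μ (Sᶜ.erase j) + x j + y i := by rw [add_comm, add_comm (y i), add_right_comm]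
      _ ≤ μ (Sᶜ.erase i) + x i + y i := by gcongr
      _ = x i + y i + μ (Sᶜ.erase i) := by rw [add_assoc, add_comm]
  exact WithTop.le_of_add_le_add_right hS this

/-- Complete `T` by a basis of the other summand. Removing an element of that basis leaves all of
`T`, which is too large to be a basis, so only the terms in `T` are finite. -/
theorem tropLinearSpace_directSum {E₁ E₂ : Type*} [DecidableEq E₁] [DecidableEq E₂] {k₁ k₂ : ℕ}
    {μ₁ : Finset E₁ → TropNum} {μ₂ : Finset E₂ → TropNum} (h₁ : IsTropProjVector k₁ μ₁)
    (h₂ : IsTropProjVector k₂ μ₂) {x : E₁ ⊕ E₂ → TropNum}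
    (hx : x ∈ tropLinearSpace (k₁ + k₂) (directSumVM μ₁ μ₂)) :
    (x ∘ Sum.inl) ∈ tropLinearSpace k₁ μ₁ ∧ (x ∘ Sum.inr) ∈ tropLinearSpace k₂ μ₂ := by
  constructor
  · intro T hT
    obtain ⟨B, hB⟩ := h₂.2
    have hcard : (T.disjSum B).card = k₁ + k₂ + 1 := by
      rw [Finset.card_disjSum, hT, h₂.card_eq hB]; omega
    refine (minTwice_iff _ _).2 fun i hi hne => ?_
    rw [Ne, WithTop.add_eq_top, not_or] at hne
    obtain ⟨j, hj, hji, hle⟩ := (minTwice_iff _ _).1 (hx _ hcard) (Sum.inl i) (by simpa using hi)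
      (by
        simp only [directSumVM, Finset.toLeft_erase_inl, Finset.toRight_erase_inl,
          Finset.toLeft_disjSum, Finset.toRight_disjSum]
        simpa [WithTop.add_eq_top, hB] using hne)
    rcases j with j | j
    · refine ⟨j, by simpa using hj, by simpa using hji, ?_⟩
      simp only [directSumVM, Finset.toLeft_erase_inl, Finset.toRight_erase_inl,
          Finset.toLeft_disjSum, Finset.toRight_disjSum] at hle
      rw [add_right_comm (μ₁ (T.erase j)), add_right_comm (μ₁ (T.erase i))] at hle
      exact WithTop.le_of_add_le_add_right hB hle
    · exfalso
      simp only [directSumVM, Finset.toLeft_erase_inl, Finset.toRight_erase_inl,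
        Finset.toLeft_erase_inr, Finset.toRight_erase_inr,
          Finset.toLeft_disjSum, Finset.toRight_disjSum] at hle
      rw [h₁.1 T (by omega)] at hle
      simp only [top_add, top_le_iff] at hle
      simp only [WithTop.add_eq_top] at hle
      have := hne.2
      simp only [Function.comp] at this
      tauto
  · intro T hT
    obtain ⟨B, hB⟩ := h₁.2
    have hcard : (B.disjSum T).card = k₁ + k₂ + 1 := by
      rw [Finset.card_disjSum, hT, h₁.card_eq hB]; omega
    refine (minTwice_iff _ _).2 fun i hi hne => ?_
    rw [Ne, WithTop.add_eq_top, not_or] at hne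
    obtain ⟨j, hj, hji, hle⟩ := (minTwice_iff _ _).1 (hx _ hcard) (Sum.inr i) (by simpa using hi)
      (by
        simp only [directSumVM, Finset.toLeft_erase_inr, Finset.toRight_erase_inr,
          Finset.toLeft_disjSum, Finset.toRight_disjSum]
        simpa [WithTop.add_eq_top, hB] using hne)
    rcases j with j | j
    · exfalso
      simp only [directSumVM, Finset.toLeft_erase_inl, Finset.toRight_erase_inl,
        Finset.toLeft_erase_inr, Finset.toRight_erase_inr,
          Finset.toLeft_disjSum, Finset.toRight_disjSum] at hle
      rw [h₂.1 T (by omega)] at hle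
      simp only [add_top, top_add, top_le_iff] at hle
      simp only [WithTop.add_eq_top] at hle
      have := hne.2
      simp only [Function.comp] at this
      tauto
    · refine ⟨j, by simpa using hj, by simpa using hji, ?_⟩
      simp only [directSumVM, Finset.toLeft_erase_inr, Finset.toRight_erase_inr,
          Finset.toLeft_disjSum, Finset.toRight_disjSum] at hle
      rw [add_assoc, add_assoc] at hle
      exact WithTop.le_of_add_le_add_left hB hle

theorem conormalBundle_isotropic {n k : ℕ} {μ : Finset (Fin n) → TropNum}
    (hμ : IsTropProjVector k μ) : TropIsotropic (conormalBundle μ) := by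
  have hL : conormalBundle μ = tropLinearSpace (k + (n - k)) (directSumVM μ (dualVM μ)) := by
    rw [Nat.add_sub_cancel' hμ.rank_le, conormalBundle]
  intro x hx y hy
  rw [hL] at hx hy
  obtain ⟨hx1, hx2⟩ := tropLinearSpace_directSum hμ hμ.dual hx
  obtain ⟨hy1, hy2⟩ := tropLinearSpace_directSum hμ hμ.dual hy
  refine (minTwice_iff _ _).2 ?_
  -- The terms at `inl` pair the left half of `x` with the right half of `y`, those at `inr` the
  -- other way round. Each family has its own second index.
  rintro (i | i) - hne
  · obtain ⟨j, -, hji, hle⟩ := (minTwice_iff _ _).1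
      (minTwice_add_of_mem_tropLinearSpace_dual hμ hx1 hy2) i (Finset.mem_univ _) hne
    exact ⟨Sum.inl j, Finset.mem_univ _, by simpa using hji, hle⟩
  · obtain ⟨j, -, hji, hle⟩ := (minTwice_iff _ _).1
      (minTwice_add_of_mem_tropLinearSpace_dual hμ hy1 hx2) i (Finset.mem_univ _)
      (by simpa [add_comm] using hne)
    exact ⟨Sum.inr j, Finset.mem_univ _, by simpa using hji, by
      simpa [add_comm] using hle⟩

/-! ### Symmetric presentations and matchings. -/

theorem stiefel_ne_top_iff {E : Type*} [DecidableEq E] {k : ℕ} {A : Matrix (Fin k) E TropNum}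
    {J : Finset E} : stiefel A J ≠ ⊤ ↔
      ∃ σ : Fin k → E, Function.Injective σ ∧ Finset.univ.image σ = J ∧ ∀ i, A i (σ i) ≠ ⊤ := by
  constructor
  · intro h
    simp only [stiefel, Ne, Finset.inf_eq_top_iff, Finset.mem_univ, true_implies, not_forall,
      WithTop.sum_eq_top, not_exists, true_and] at h
    obtain ⟨σ, hσ⟩ := h
    refine ⟨fun i => σ i, Subtype.val_injective.comp σ.injective, ?_, hσ⟩
    ext e
    simp only [Finset.mem_image, Finset.mem_univ, true_and]
    exact ⟨fun ⟨i, hi⟩ => hi ▸ (σ i).2, fun he => ⟨σ.symm ⟨e, he⟩, by simp⟩⟩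
  · rintro ⟨σ, hσ, rfl, hA⟩
    simp only [stiefel, Ne, Finset.inf_eq_top_iff, Finset.mem_univ, true_implies, not_forall,
      WithTop.sum_eq_top, not_exists, true_and]
    refine ⟨Equiv.ofBijective (fun i => ⟨σ i, Finset.mem_image_of_mem σ (Finset.mem_univ i)⟩)
      ⟨fun i j h => hσ (congrArg Subtype.val h), ?_⟩, hA⟩
    rintro ⟨e, he⟩
    obtain ⟨i, -, rfl⟩ := Finset.mem_image.1 he
    exact ⟨i, rfl⟩

theorem IsPresentation.ne_top_iff {E : Type*} [DecidableEq E] {k : ℕ}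
    {A : Matrix (Fin k) E TropNum} {μ : Finset E → TropNum} (h : IsPresentation A μ)
    {J : Finset E} : μ J ≠ ⊤ ↔
      ∃ σ : Fin k → E, Function.Injective σ ∧ Finset.univ.image σ = J ∧ ∀ i, A i (σ i) ≠ ⊤ := by
  obtain ⟨c, hc⟩ := h
  rw [← stiefel_ne_top_iff, hc, Ne, WithTop.add_eq_top]
  simp

theorem injective_update_of_forall_ne {α β : Type*} [DecidableEq α] {σ : α → β}
    (hσ : Function.Injective σ) {a : α} {b : β} (hb : ∀ x, x ≠ a → σ x ≠ b) :
    Function.Injective (Function.update σ a b) := by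
  intro x y hxy
  by_cases hx : x = a <;> by_cases hy : y = a
  · rw [hx, hy]
  · subst hx
    rw [Function.update_self, Function.update_of_ne hy] at hxy
    exact absurd hxy.symm (hb y hy)
  · subst hy
    rw [Function.update_self, Function.update_of_ne hx] at hxy
    exact absurd hxy (hb x hx)
  · rw [Function.update_of_ne hx, Function.update_of_ne hy] at hxy
    exact hσ hxy

theorem image_update_toLeft_card {α E₁ E₂ : Type*} [Fintype α] [DecidableEq α] [DecidableEq E₁]
    [DecidableEq E₂] {σ : α → E₁ ⊕ E₂} {a : α} {e : E₁} {f : E₂}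
    (ha : σ a = Sum.inr f) (he : ∀ x, x ≠ a → σ x ≠ Sum.inl e) :
    (Finset.univ.image (Function.update σ a (Sum.inl e))).toLeft.card =
      (Finset.univ.image σ).toLeft.card + 1 := by
  have h : (Finset.univ.image (Function.update σ a (Sum.inl e))).toLeft =
      insert e (Finset.univ.image σ).toLeft := by
    ext x
    simp only [Finset.mem_toLeft, Finset.mem_image, Finset.mem_univ, true_and, Finset.mem_insert]
    constructor
    · rintro ⟨i, hi⟩
      by_cases hia : i = a
      · subst hia
        rw [Function.update_self] at hi
        exact Or.inl (Sum.inl_injective hi).symm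
      · rw [Function.update_of_ne hia] at hi
        exact Or.inr ⟨i, hi⟩
    · rintro (rfl | ⟨i, hi⟩)
      · exact ⟨a, Function.update_self _ _ _⟩
      · refine ⟨i, ?_⟩
        rw [Function.update_of_ne, hi]
        rintro rfl
        simp [ha] at hi
  rw [h, Finset.card_insert_of_notMem]
  simp only [Finset.mem_toLeft, Finset.mem_image, Finset.mem_univ, true_and, not_exists]
  intro x hx
  by_cases hxa : x = a
  · subst hxa
    simp [ha] at hx
  · exact he x hxa hx

/-- If the matchings of a bipartite relation `P` between `α` and `E₁ ⊕ E₂` that cover `α` all have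
the same number of ends in `E₁`, then no `q : α` is related to both an element of `E₁` and an
element of `E₂` that can be avoided by such matchings. -/
theorem false_of_balanced_matchings {α E₁ E₂ : Type*} [Fintype α] [DecidableEq α] [DecidableEq E₁]
    [DecidableEq E₂] {P : α → E₁ ⊕ E₂ → Prop} {k : ℕ}
    (hbal : ∀ σ : α → E₁ ⊕ E₂, Function.Injective σ → (∀ i, P i (σ i)) →
      (Finset.univ.image σ).toLeft.card = k)
    {q : α} {e : E₁} {f : E₂} (hqe : P q (Sum.inl e)) (hqf : P q (Sum.inr f))
    {σ τ : α → E₁ ⊕ E₂} (hσ : Function.Injective σ) (hσP : ∀ i, P i (σ i))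
    (hσe : ∀ i, σ i ≠ Sum.inl e) (hτ : Function.Injective τ) (hτP : ∀ i, P i (τ i))
    (hτf : ∀ i, τ i ≠ Sum.inr f) : False := by
  classical
  have hupd : ∀ (ρ : α → E₁ ⊕ E₂) (b : E₁ ⊕ E₂), (∀ i, P i (ρ i)) → P q b →
      ∀ i, P i (Function.update ρ q b i) := by
    intro ρ b hρ hb i
    by_cases hi : i = q
    · subst hi; simpa using hb
    · simpa [Function.update_of_ne hi] using hρ i
  -- Otherwise moving `q` from its end in `E₂` to `e` would raise the number of ends in `E₁` by one.
  -- Both cases below end by violating this.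
  have hleft : ∀ ρ : α → E₁ ⊕ E₂, Function.Injective ρ → (∀ i, P i (ρ i)) →
      (∀ i, i ≠ q → ρ i ≠ Sum.inl e) → ∀ f', ρ q ≠ Sum.inr f' := by
    intro ρ h1 h2 h3 f' hf'
    have h4 := image_update_toLeft_card hf' h3
    rw [hbal _ h1 h2, hbal _ (injective_update_of_forall_ne h1 h3) (hupd ρ _ h2 hqe)] at h4
    omega
  have hτq : ∃ f', τ q = Sum.inr f' := by
    rcases hx : τ q with e' | f'
    · exfalso
      have h1 : Function.Injective (Function.update τ q (Sum.inr f)) :=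
        injective_update_of_forall_ne hτ fun i _ => hτf i
      have h2 := image_update_toLeft_card (e := e') (f := f) (a := q) (σ := Function.update τ q (Sum.inr f)) (Function.update_self _ _ _) (by
        intro x hx'
        rw [Function.update_of_ne hx', ← hx]
        exact hτ.ne hx')
      rw [Function.update_idem, ← hx, Function.update_eq_self, hbal _ hτ hτP,
        hbal _ h1 (hupd τ _ hτP hqf)] at h2
      omega
    · exact ⟨f', rfl⟩
  obtain ⟨f', hf'⟩ := hτq
  -- The vertices of `α` on the path from `q` that alternates between edges of `τ` and `σ`.
  let X : α → Prop := Relation.ReflTransGen (fun x y => τ x = σ y) q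
  have hXq : X q := Relation.ReflTransGen.refl
  have hXclosed : ∀ x y, X x → τ x = σ y → X y := fun x y hx h => hx.tail h
  have hXpred : ∀ x, X x → x ≠ q → ∃ x', X x' ∧ τ x' = σ x := by
    intro x hx hne
    rcases Relation.ReflTransGen.cases_tail hx with h | ⟨c, hc, hcx⟩
    · exact absurd h hne
    · exact ⟨c, hc, hcx⟩
  by_cases hXe : ∃ x, X x ∧ τ x = Sum.inl e
  · obtain ⟨x₀, hx₀, hx₀e⟩ := hXe
    -- The path ends at `e`: switching `τ` to `σ` along it frees `e` for `q`. The new matching still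
    -- avoids `f`, because on the path `σ` only reuses ends of `τ`.
    let ρ : α → E₁ ⊕ E₂ := fun x => if x = q then Sum.inl e else if X x then σ x else τ x
    have hρq : ρ q = Sum.inl e := if_pos rfl
    have hρX : ∀ x, x ≠ q → X x → ρ x = σ x := fun x h1 h2 => by simp [ρ, h1, h2]
    have hρn : ∀ x, ¬ X x → ρ x = τ x := fun x h => by
      have : x ≠ q := by rintro rfl; exact h hXq
      simp [ρ, this, h]
    have hρe : ∀ x, x ≠ q → ρ x ≠ Sum.inl e := by
      intro x hx
      by_cases hX : X x
      · rw [hρX x hx hX]; exact hσe x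
      · rw [hρn x hX, ← hx₀e]
        intro h
        exact hX (hτ h ▸ hx₀)
    have hcross : ∀ x y, x ≠ q → X x → ¬ X y → σ x ≠ τ y := by
      intro x y hx hX hY h
      obtain ⟨x', hx', hxx'⟩ := hXpred x hX hx
      exact hY (hτ (hxx'.trans h) ▸ hx')
    have hρinj : Function.Injective ρ := by
      intro x y hxy
      by_cases hx : x = q <;> by_cases hy : y = q
      · rw [hx, hy]
      · subst hx; exact absurd (hxy.symm.trans hρq) (hρe y hy)
      · subst hy; exact absurd (hxy.trans hρq) (hρe x hx)
      · by_cases hX : X x <;> by_cases hY : X y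
        · rw [hρX x hx hX, hρX y hy hY] at hxy; exact hσ hxy
        · rw [hρX x hx hX, hρn y hY] at hxy; exact absurd hxy (hcross x y hx hX hY)
        · rw [hρn x hX, hρX y hy hY] at hxy; exact absurd hxy.symm (hcross y x hy hY hX)
        · rw [hρn x hX, hρn y hY] at hxy; exact hτ hxy
    have hρP : ∀ i, P i (ρ i) := by
      intro i
      by_cases hi : i = q
      · subst hi; rwa [hρq]
      · by_cases hX : X i
        · rw [hρX i hi hX]; exact hσP i
        · rw [hρn i hX]; exact hτP i
    have hρf : ∀ i, i ≠ q → ρ i ≠ Sum.inr f := by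
      intro i hi
      by_cases hX : X i
      · rw [hρX i hi hX]
        obtain ⟨x', -, hxx'⟩ := hXpred i hX hi
        rw [← hxx']
        exact hτf x'
      · rw [hρn i hX]; exact hτf i
    -- Moving `q` on to `f` gives a matching with `q` in `E₂` and `e` unused.
    refine hleft _ (injective_update_of_forall_ne hρinj hρf) (hupd ρ _ hρP hqf) ?_ f
      (Function.update_self _ _ _)
    intro i hi
    rw [Function.update_of_ne hi]
    exact hρe i hi
  · push Not at hXe
    -- The path misses `e`: switching `σ` to `τ` along it puts `q` in `E₂` and leaves `e` unused.
    let ρ : α → E₁ ⊕ E₂ := fun x => if X x then τ x else σ x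
    have hρX : ∀ x, X x → ρ x = τ x := fun x h => if_pos h
    have hρn : ∀ x, ¬ X x → ρ x = σ x := fun x h => if_neg h
    refine hleft ρ ?_ ?_ ?_ f' ((hρX q hXq).trans hf')
    · intro x y hxy
      by_cases hX : X x <;> by_cases hY : X y
      · rw [hρX x hX, hρX y hY] at hxy; exact hτ hxy
      · rw [hρX x hX, hρn y hY] at hxy; exact absurd (hXclosed x y hX hxy) hY
      · rw [hρn x hX, hρX y hY] at hxy; exact absurd (hXclosed y x hY hxy.symm) hX
      · rw [hρn x hX, hρn y hY] at hxy; exact hσ hxy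
    · intro i
      by_cases hX : X i
      · rw [hρX i hX]; exact hτP i
      · rw [hρn i hX]; exact hσP i
    · intro i _
      by_cases hX : X i
      · rw [hρX i hX]; exact hXe i hX
      · rw [hρn i hX]; exact hσe i

theorem existsUnique_basis_of_hasSymmetricPresentation {n k : ℕ} {μ : Finset (Fin n) → TropNum}
    (hμ : IsTropProjVector k μ) (h : HasSymmetricPresentation n (directSumVM μ (dualVM μ))) :
    ∃! B, μ B ≠ ⊤ := by
  obtain ⟨A, B, hpres, hsymm⟩ := h
  obtain ⟨J₁, hJ₁⟩ := hμ.2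
  refine ⟨J₁, hJ₁, fun J₂ hJ₂ => ?_⟩
  by_contra hne
  have hcard : J₁.card = J₂.card := (hμ.card_eq hJ₁).trans (hμ.card_eq hJ₂).symm
  obtain ⟨l, hl₁, hl₂⟩ : ∃ l ∈ J₁, l ∉ J₂ := by
    by_contra hcon
    push Not at hcon
    exact hne (Finset.eq_of_subset_of_card_le hcon hcard.ge).symm
  set P : Fin n → Fin n ⊕ Fin n → Prop := fun i e => Matrix.fromCols A B i e ≠ ⊤ with hP
  -- matchings with a given image
  have hmatch : ∀ J K : Finset (Fin n), μ J ≠ ⊤ → μ K ≠ ⊤ → ∃ σ : Fin n → Fin n ⊕ Fin n,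
      Function.Injective σ ∧ (∀ i, P i (σ i)) ∧ (∀ a, (∃ i, σ i = Sum.inl a) ↔ a ∈ J) ∧
        (∀ a, (∃ i, σ i = Sum.inr a) ↔ a ∉ K) := by
    intro J K hJ hK
    have : directSumVM μ (dualVM μ) (J.disjSum Kᶜ) ≠ ⊤ :=
      directSumVM_ne_top.2 (by simpa [dualVM] using ⟨hJ, hK⟩)
    obtain ⟨σ, h1, h2, h3⟩ := hpres.ne_top_iff.1 this
    refine ⟨σ, h1, h3, fun a => ?_, fun a => ?_⟩
    · have := Finset.ext_iff.1 h2 (Sum.inl a)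
      simpa using this
    · have := Finset.ext_iff.1 h2 (Sum.inr a)
      simpa using this
  have hbasis : ∀ σ : Fin n → Fin n ⊕ Fin n, Function.Injective σ → (∀ i, P i (σ i)) →
      μ (Finset.univ.image σ).toLeft ≠ ⊤ ∧ μ (Finset.univ.image σ).toRightᶜ ≠ ⊤ := by
    intro σ h1 h2
    exact directSumVM_ne_top.1 (hpres.ne_top_iff.2 ⟨σ, h1, rfl, h2⟩)
  have hbal : ∀ σ : Fin n → Fin n ⊕ Fin n, Function.Injective σ → (∀ i, P i (σ i)) →
      (Finset.univ.image σ).toLeft.card = k := fun σ h1 h2 => hμ.card_eq (hbasis σ h1 h2).1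
  obtain ⟨σ₁, hσ₁, hσ₁P, hσ₁l, hσ₁r⟩ := hmatch J₁ J₁ hJ₁ hJ₁
  obtain ⟨σ₂, hσ₂, hσ₂P, hσ₂l, hσ₂r⟩ := hmatch J₂ J₂ hJ₂ hJ₂
  obtain ⟨r, hr⟩ := (hσ₁l l).2 hl₁
  obtain ⟨q, hq⟩ := (hσ₂r l).2 hl₂
  have hrl : A r l ≠ ⊤ := by simpa [hP, hr] using hσ₁P r
  have hql : B q l ≠ ⊤ := by simpa [hP, hq] using hσ₂P q
  -- By symmetry the entry at `(q, r)` is finite as well, through some `l'`. Row `q` is then joined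
  -- to `l'` on the left and to `l` on the right.
  have hrq : tropMulTranspose A B r q ≠ ⊤ := by
    simp only [tropMulTranspose, Matrix.of_apply, Ne, Finset.inf_eq_top_iff, not_forall]
    exact ⟨l, Finset.mem_univ _, by simp [hrl, hql]⟩
  rw [← hsymm.apply] at hrq
  simp only [tropMulTranspose, Matrix.of_apply, Ne, Finset.inf_eq_top_iff, not_forall,
    Finset.mem_univ, true_implies, WithTop.add_eq_top, not_or] at hrq
  obtain ⟨l', hql', hrl'⟩ := hrq
  -- a matching through the entry `(r, inr l')`
  obtain ⟨ρ, hρ, hρP, i₀, hρi⟩ : ∃ ρ : Fin n → Fin n ⊕ Fin n, Function.Injective ρ ∧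
      (∀ i, P i (ρ i)) ∧ ∃ i, ρ i = Sum.inr l' := by
    by_cases hex : ∃ i, σ₁ i = Sum.inr l'
    · exact ⟨σ₁, hσ₁, hσ₁P, hex⟩
    · push Not at hex
      refine ⟨Function.update σ₁ r (Sum.inr l'),
        injective_update_of_forall_ne hσ₁ fun x _ => hex x, fun i => ?_, r,
        Function.update_self _ _ _⟩
      by_cases hi : i = r
      · subst hi
        rw [Function.update_self]
        simpa [hP] using hrl'
      · rw [Function.update_of_ne hi]
        exact hσ₁P i
  -- The complement of the right half of the image of `ρ` is a basis K of `μ` without `l'`. The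
  -- matching onto K ⊔ Kᶜ avoids `inl l'`, while `σ₁` avoids `inr l`.
  have hK := (hbasis ρ hρ hρP).2
  obtain ⟨σ, hσ, hσP, hσl, -⟩ := hmatch _ _ hK hK
  refine false_of_balanced_matchings (P := P) hbal (q := q) (e := l') (f := l)
    (by simpa [hP] using hql') (by simpa [hP] using hql) hσ hσP ?_ hσ₁ hσ₁P ?_
  · intro i hi
    have := (hσl l').1 ⟨i, hi⟩
    simp only [Finset.mem_compl, Finset.mem_toRight, Finset.mem_image, Finset.mem_univ, true_and,
      not_exists] at this
    exact this i₀ hρi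
  · intro i hi
    exact (hσ₁r l).1 ⟨i, hi⟩ hl₁

theorem hasSymmetricPresentation_of_existsUnique_basis {n : ℕ} {μ : Finset (Fin n) → TropNum}
    (h : ∃! B, μ B ≠ ⊤) : HasSymmetricPresentation n (directSumVM μ (dualVM μ)) := by
  obtain ⟨J₀, hJ₀, huniq⟩ := h
  let A : Matrix (Fin n) (Fin n) TropNum := Matrix.of fun i j => if i = j ∧ i ∈ J₀ then 0 else ⊤
  let B : Matrix (Fin n) (Fin n) TropNum := Matrix.of fun i j => if i = j ∧ i ∉ J₀ then 0 else ⊤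
  let f : Fin n → Fin n ⊕ Fin n := fun i => if i ∈ J₀ then Sum.inl i else Sum.inr i
  have hAB : ∀ i e, Matrix.fromCols A B i e = if e = f i then 0 else ⊤ := by
    rintro i (j | j) <;> by_cases hi : i ∈ J₀ <;> 
      simp only [Matrix.fromCols_apply_inl, Matrix.fromCols_apply_inr] <;>
      simp [A, B, f, hi, eq_comm]
  have hf : Function.Injective f := by
    intro i j hij
    by_cases hi : i ∈ J₀ <;> by_cases hj : j ∈ J₀ <;> simp [f, hi, hj] at hij <;> exact hij
  have hfimg : Finset.univ.image f = J₀.disjSum J₀ᶜ := by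
    ext (j | j)
    · simp only [Finset.mem_image, Finset.mem_univ, true_and, Finset.inl_mem_disjSum]
      constructor
      · rintro ⟨i, hi⟩
        by_cases h : i ∈ J₀ <;> simp [f, h] at hi
        exact hi ▸ h
      · intro hj
        exact ⟨j, by simp [f, hj]⟩
    · simp only [Finset.mem_image, Finset.mem_univ, true_and, Finset.inr_mem_disjSum,
        Finset.mem_compl]
      constructor
      · rintro ⟨i, hi⟩
        by_cases h : i ∈ J₀ <;> simp [f, h] at hi
        exact hi ▸ h
      · intro hj
        exact ⟨j, by simp [f, hj]⟩
  have hstief : ∀ J, stiefel (Matrix.fromCols A B) J ≠ ⊤ ↔ J = J₀.disjSum J₀ᶜ := by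
    intro J
    rw [stiefel_ne_top_iff, ← hfimg]
    constructor
    · rintro ⟨σ, -, rfl, h⟩
      congr 1
      ext i : 1
      by_contra hne
      exact h i (by rw [hAB, if_neg hne])
    · rintro rfl
      exact ⟨f, hf, rfl, fun i => by simp [hAB]⟩
  have hzero : stiefel (Matrix.fromCols A B) (J₀.disjSum J₀ᶜ) = 0 := by
    refine le_antisymm ?_ (Finset.le_inf fun σ _ => Finset.sum_nonneg fun i _ => ?_)
    · let σ : Fin n ≃ {x // x ∈ J₀.disjSum J₀ᶜ} := Equiv.ofBijective (fun i => ⟨f i, hfimg ▸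
        Finset.mem_image_of_mem f (Finset.mem_univ i)⟩) ⟨fun i j h => hf (congrArg Subtype.val h), by
          rintro ⟨e, he⟩
          rw [← hfimg] at he
          obtain ⟨i, -, rfl⟩ := Finset.mem_image.1 he
          exact ⟨i, rfl⟩⟩
      have hσ : ∀ i, (σ i : Fin n ⊕ Fin n) = f i := fun i => rfl
      exact (Finset.inf_le (Finset.mem_univ σ)).trans
        (Finset.sum_eq_zero fun i _ => by simp [hAB, hσ]).le
    · rw [hAB]
      split_ifs <;> simp
  -- The only finite value of μ ⊕ μ*, at J₀ ⊔ J₀ᶜ, is twice the value of the basis.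
  refine ⟨A, B, ⟨(μ J₀ + μ J₀).untop (by simpa using hJ₀), fun J => ?_⟩, ?_⟩
  · rw [WithTop.coe_untop]
    by_cases hJ : J = J₀.disjSum J₀ᶜ
    · rw [hJ, hzero, zero_add]
      simp [directSumVM, dualVM]
    · have h1 : stiefel (Matrix.fromCols A B) J = ⊤ := by
        by_contra hc
        exact hJ ((hstief J).1 hc)
      rw [h1, top_add]
      by_contra hc
      obtain ⟨h2, h3⟩ := directSumVM_ne_top.1 hc
      have h4 := huniq _ h3
      apply hJ
      rw [Finset.eq_disjSum_iff, huniq _ h2, ← h4, compl_compl]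
      exact ⟨rfl, rfl⟩
  · have : ∀ i j, tropMulTranspose A B i j = ⊤ := by
      intro i j
      simp only [tropMulTranspose, Matrix.of_apply, Finset.inf_eq_top_iff]
      intro l _
      by_cases h1 : i = l ∧ i ∈ J₀
      · have h2 : ¬ (j = l ∧ j ∉ J₀) := by
          rintro ⟨h3, h4⟩
          exact h4 (h3.trans h1.1.symm ▸ h1.2)
        simp [B, if_neg h2]
      · simp [A, if_neg h1]
    ext i j
    rw [Matrix.transpose_apply, this, this]

/-! ### Plücker and symplectic relations between maximal minors. -/

theorem orderEmbOfFin_erase {E : Type*} [LinearOrder E] {T : Finset E} {m : ℕ}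
    (hT : T.card = m + 1) {i : E} (hi : i ∈ T) (hS : (T.erase i).card = m) :
    ∃ j : Fin (m + 1), T.orderEmbOfFin hT j = i ∧
      (∀ x, T.orderEmbOfFin hT (j.succAbove x) = (T.erase i).orderEmbOfFin hS x) ∧
      ((T.erase i).filter fun s => s < i).card = j := by
  obtain ⟨j, hj⟩ : i ∈ Set.range (T.orderEmbOfFin hT) := by
    rw [Finset.range_orderEmbOfFin]; exact hi
  refine ⟨j, hj, ?_, ?_⟩
  · have := Finset.orderEmbOfFin_unique hS (f := fun x => T.orderEmbOfFin hT (j.succAbove x))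
      (fun x => by
        refine Finset.mem_erase.2 ⟨?_, Finset.orderEmbOfFin_mem _ _ _⟩
        rw [← hj]
        exact (T.orderEmbOfFin hT).injective.ne (Fin.succAbove_ne j x))
      ((T.orderEmbOfFin hT).strictMono.comp (Fin.strictMono_succAbove j))
    exact fun x => congrFun this x
  · have : (T.erase i).filter (fun s => s < i) =
        (Finset.Iio j).map (T.orderEmbOfFin hT).toEmbedding := by
      ext s
      simp only [Finset.mem_filter, Finset.mem_erase, Finset.mem_map, Finset.mem_Iio,
        RelEmbedding.coe_toEmbedding]
      constructor
      · rintro ⟨⟨-, h1⟩, h2⟩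
        obtain ⟨x, rfl⟩ : s ∈ Set.range (T.orderEmbOfFin hT) := by
          rw [Finset.range_orderEmbOfFin]; exact h1
        rw [← hj] at h2
        exact ⟨x, (T.orderEmbOfFin hT).lt_iff_lt.1 h2, rfl⟩
      · rintro ⟨x, hx, rfl⟩
        have : T.orderEmbOfFin hT x < i := hj ▸ (T.orderEmbOfFin hT).lt_iff_lt.2 hx
        exact ⟨⟨this.ne, Finset.orderEmbOfFin_mem _ _ _⟩, this⟩
    rw [this, Finset.card_map, Fin.card_Iio]

/-- The maximal minor of `N` in the columns `J`, and `0` if `J` has the wrong size. -/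
noncomputable def maximalMinor {R E : Type*} [CommRing R] [LinearOrder E] {k : ℕ}
    (N : Matrix (Fin k) E R) (J : Finset E) : R :=
  if h : J.card = k then (N.submatrix id (J.orderEmbOfFin h)).det else 0

theorem maximalMinor_of_card {R E : Type*} [CommRing R] [LinearOrder E] {k : ℕ}
    (N : Matrix (Fin k) E R) {J : Finset E} (h : J.card = k) :
    maximalMinor N J = (N.submatrix id (J.orderEmbOfFin h)).det := dif_pos h

theorem det_submatrix_cons {R E : Type*} [CommRing R] {m : ℕ} (N : Matrix (Fin (m + 1)) E R)
    (a : E) (g : Fin m → E) :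
    (N.submatrix id (Fin.cons a g : Fin (m + 1) → E)).det =
      ∑ r : Fin (m + 1), (-1) ^ (r : ℕ) * N r a * (N.submatrix r.succAbove g).det := by
  rw [Matrix.det_succ_column_zero]
  rfl

theorem det_submatrix_eq_cons {R E : Type*} [CommRing R] {m : ℕ} (N : Matrix (Fin (m + 1)) E R)
    (f : Fin (m + 1) → E) (j : Fin (m + 1)) :
    (N.submatrix id f).det =
      (-1) ^ (j : ℕ) * (N.submatrix id (Fin.cons (f j) (f ∘ j.succAbove) : Fin (m + 1) → E)).det := by
  rw [det_submatrix_cons, Matrix.det_succ_column _ j, Finset.mul_sum]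
  refine Finset.sum_congr rfl fun r _ => ?_
  rw [pow_add]
  simp only [Matrix.submatrix_apply, Matrix.submatrix_submatrix, id, Function.id_comp]
  ring

/-- Moving column `i` from its sorted place to the front passes the smaller elements of `S`. With
`i` in front, the determinant is defined for every `i` and linear in its column. -/
theorem maximalMinor_insert {R E : Type*} [CommRing R] [LinearOrder E] {m : ℕ}
    (N : Matrix (Fin (m + 1)) E R) {S : Finset E} (hS : S.card = m) {i : E} (hi : i ∉ S) :
    maximalMinor N (insert i S) = (-1) ^ (S.filter fun s => s < i).card *
      (N.submatrix id (Fin.cons i (S.orderEmbOfFin hS) : Fin (m + 1) → E)).det := by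
  have hT : (insert i S).card = m + 1 := by rw [Finset.card_insert_of_notMem hi, hS]
  have he : (insert i S).erase i = S := Finset.erase_insert hi
  obtain ⟨j, h1, h2, h3⟩ := orderEmbOfFin_erase hT (Finset.mem_insert_self i S) (by rw [he, hS])
  simp only [he] at h2 h3
  rw [maximalMinor_of_card N hT, det_submatrix_eq_cons N _ j, h1, h3]
  congr 4
  exact funext h2

theorem det_submatrix_cons_of_mem {R E : Type*} [CommRing R] [LinearOrder E] {m : ℕ}
    (N : Matrix (Fin (m + 1)) E R) {S : Finset E} (hS : S.card = m) {i : E} (hi : i ∈ S) :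
    (N.submatrix id (Fin.cons i (S.orderEmbOfFin hS) : Fin (m + 1) → E)).det = 0 := by
  obtain ⟨x, hx⟩ : i ∈ Set.range (S.orderEmbOfFin hS) := by
    rw [Finset.range_orderEmbOfFin]; exact hi
  refine Matrix.det_zero_of_column_eq (i := 0) (j := x.succ) (Fin.succ_ne_zero x).symm fun r => ?_
  simp [hx]

theorem card_filter_lt_add_card_filter_gt {E : Type*} [LinearOrder E] {S : Finset E} {i : E}
    (hi : i ∉ S) : (S.filter fun s => s < i).card + (S.filter fun s => i < s).card = S.card := by
  rw [← Finset.card_filter_add_card_filter_not (s := S) (fun s => s < i)]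
  congr 2
  refine Finset.filter_congr fun s hs => ?_
  have : s ≠ i := fun h => hi (h ▸ hs)
  rw [not_lt]
  exact ⟨le_of_lt, fun h => lt_of_le_of_ne h this.symm⟩

theorem neg_one_pow_card_filter {R E : Type*} [CommRing R] [LinearOrder E] {S : Finset E} {i : E}
    (hi : i ∉ S) : (-1 : R) ^ (S.filter fun s => i < s).card =
      (-1) ^ S.card * (-1) ^ (S.filter fun s => s < i).card := by
  rw [← card_filter_lt_add_card_filter_gt hi, pow_add, mul_right_comm, ← pow_add, ← two_mul,
    pow_mul]
  simp

/-- Laplace expansion along the top row of the square matrix of columns `T` in which row `r` is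
repeated on top. -/
theorem sum_mul_maximalMinor_erase {R E : Type*} [CommRing R] [LinearOrder E] {k : ℕ}
    (N : Matrix (Fin k) E R) {T : Finset E} (hT : T.card = k + 1) (r : Fin k) :
    ∑ i ∈ T, (-1) ^ (T.filter fun t => t < i).card * N r i * maximalMinor N (T.erase i) = 0 := by
  let e := T.orderEmbOfFin hT
  let Q : Matrix (Fin (k + 1)) (Fin (k + 1)) R :=
    Matrix.of (Fin.cons (fun x => N r (e x)) (fun s x => N s (e x)) : Fin (k + 1) → Fin (k + 1) → R)
  have hQ : Q.det = 0 :=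
    Matrix.det_zero_of_row_eq (i := 0) (j := r.succ) (Fin.succ_ne_zero r).symm (by
      ext x; simp [Q])
  rw [← hQ, Matrix.det_succ_row_zero, ← Finset.map_orderEmbOfFin_univ T hT, Finset.sum_map]
  refine Finset.sum_congr rfl fun x _ => ?_
  simp only [Finset.map_orderEmbOfFin_univ, RelEmbedding.coe_toEmbedding]
  have hx : e x ∈ T := Finset.orderEmbOfFin_mem _ _ _
  have hc : (T.erase (e x)).card = k := by rw [Finset.card_erase_of_mem hx, hT]; rfl
  obtain ⟨j, h1, h2, h3⟩ := orderEmbOfFin_erase hT hx hc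
  obtain rfl : j = x := e.injective h1
  have h4 : (T.filter fun t => t < e j) = (T.erase (e j)).filter fun t => t < e j := by
    ext t
    simp only [Finset.mem_filter, Finset.mem_erase]
    exact ⟨fun h => ⟨⟨h.2.ne, h.1⟩, h.2⟩, fun h => ⟨h.1.2, h.2⟩⟩
  change (-1) ^ (T.filter fun t => t < e j).card * N r (e j) * maximalMinor N (T.erase (e j)) = _
  rw [h4, h3, maximalMinor_of_card N hc]
  congr 2
  ext a b
  simp only [Matrix.submatrix_apply, id, ← h2 b]
  rfl

/-- The minor of S ∪ i is expanded along column `i`. For each row `r` the sum over `i` is then a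
multiple of `sum_mul_maximalMinor_erase`; terms with `i` in `S` can be added because a column
repeats. -/
theorem maximalMinor_plucker {R E : Type*} [CommRing R] [LinearOrder E] {k : ℕ}
    (N : Matrix (Fin k) E R) {S T : Finset E} (hS : S.card + 1 = k) (hT : T.card = k + 1) :
    ∑ i ∈ T \ S, (-1) ^ ((T.filter fun t => t < i).card + (S.filter fun s => i < s).card) *
      (maximalMinor N (T.erase i) * maximalMinor N (insert i S)) = 0 := by
  obtain ⟨m, hm⟩ : ∃ m, S.card = m := ⟨_, rfl⟩
  obtain rfl : k = m + 1 := by omega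
  let q : E → R := fun i =>
    (N.submatrix id (Fin.cons i (S.orderEmbOfFin hm) : Fin (m + 1) → E)).det
  have h1 : ∀ i ∈ T \ S, (-1) ^ ((T.filter fun t => t < i).card + (S.filter fun s => i < s).card) *
      (maximalMinor N (T.erase i) * maximalMinor N (insert i S)) =
      (-1) ^ m * ((-1) ^ (T.filter fun t => t < i).card * maximalMinor N (T.erase i) * q i) := by
    intro i hi
    have hiS := (Finset.mem_sdiff.1 hi).2
    rw [maximalMinor_insert N hm hiS, pow_add, neg_one_pow_card_filter hiS, hm]
    have h2 : ((-1 : R) ^ (S.filter fun s => s < i).card) *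
        (-1 : R) ^ (S.filter fun s => s < i).card = 1 := by
      rw [← pow_add, ← two_mul, pow_mul]; simp
    linear_combination ((-1) ^ (T.filter fun t => t < i).card * (-1) ^ m *
      maximalMinor N (T.erase i) * q i) * h2
  rw [Finset.sum_congr rfl h1, ← Finset.mul_sum]
  have h2 : ∑ i ∈ T \ S, ((-1) ^ (T.filter fun t => t < i).card * maximalMinor N (T.erase i) * q i) =
      ∑ i ∈ T, ((-1) ^ (T.filter fun t => t < i).card * maximalMinor N (T.erase i) * q i) := by
    refine Finset.sum_subset Finset.sdiff_subset fun i hiT hi => ?_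
    have : q i = 0 := det_submatrix_cons_of_mem N hm (by simpa [hiT] using hi)
    rw [this, mul_zero]
  rw [h2]
  simp only [q, det_submatrix_cons, Finset.mul_sum]
  rw [Finset.sum_comm]
  have h3 : ∀ r : Fin (m + 1), ∑ i ∈ T, (-1) ^ m * ((-1) ^ (T.filter fun t => t < i).card *
      maximalMinor N (T.erase i) *
        ((-1) ^ (r : ℕ) * N r i * (N.submatrix r.succAbove (S.orderEmbOfFin hm)).det)) =
      (-1) ^ m * (-1) ^ (r : ℕ) * (N.submatrix r.succAbove (S.orderEmbOfFin hm)).det *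
        ∑ i ∈ T, (-1) ^ (T.filter fun t => t < i).card * N r i * maximalMinor N (T.erase i) := by
    intro r
    rw [Finset.mul_sum]
    exact Finset.sum_congr rfl fun i _ => by ring
  simp only [h3, sum_mul_maximalMinor_erase N hT, mul_zero, Finset.sum_const_zero]

/-- Off-diagonal terms cancel in pairs and diagonal ones vanish separately, so characteristic 2 is
no exception. -/
theorem sum_symm_mul_alternating {R ι : Type*} [CommRing R] [Fintype ι] [DecidableEq ι] {A : ι → ι → R}
    {G : ι → ι → R} (hA : ∀ r q, A r q = A q r) (hG : ∀ r, G r r = 0)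
    (hG' : ∀ r q, G r q = - G q r) : ∑ r, ∑ q, A r q * G r q = 0 := by
  rw [← Fintype.sum_prod_type' (f := fun r q => A r q * G r q)]
  refine Finset.sum_involution (fun x _ => x.swap) ?_ ?_ (fun _ _ => Finset.mem_univ _)
    (fun _ _ => Prod.swap_swap _)
  · rintro ⟨r, q⟩ -
    simp only [Prod.swap_prod_mk]
    rw [hA q r, hG' q r]; ring
  · rintro ⟨r, q⟩ - hne heq
    simp only [Prod.swap_prod_mk, Prod.mk.injEq] at heq
    apply hne
    simp [heq.1, hG]

/-- With the columns `g` fixed, the determinant is an alternating bilinear form in its first two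
columns. It is evaluated on the sum of the tensors of the columns a_i and b_i, which is symmetric by
`hN`. -/
theorem sum_det_submatrix_cons_cons {R E ι : Type*} [CommRing R] [Fintype ι] {m : ℕ}
    (N : Matrix (Fin (m + 2)) E R) (a b : ι → E) (g : Fin m → E)
    (hN : ∀ r q, ∑ i, N r (a i) * N q (b i) = ∑ i, N q (a i) * N r (b i)) :
    ∑ i, (N.submatrix id (Fin.cons (a i) (Fin.cons (b i) g : Fin (m + 1) → E) :
      Fin (m + 2) → E)).det = 0 := by
  let V := Fin (m + 2) → R
  let col : E → V := fun e r => N r e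
  let D : V [⋀^Fin (m + 2)]→ₗ[R] R := Matrix.detRowAlternating
  let G : V → V → R := fun x y => ((D.curryLeft x).curryLeft y) fun j => col (g j)
  have hdet : ∀ i, (N.submatrix id (Fin.cons (a i) (Fin.cons (b i) g : Fin (m + 1) → E) :
      Fin (m + 2) → E)).det = G (col (a i)) (col (b i)) := by
    intro i
    rw [← Matrix.det_transpose]
    change Matrix.detRowAlternating _ = Matrix.detRowAlternating _
    congr 1
    ext x r
    refine Fin.cases ?_ (fun x => Fin.cases ?_ (fun x => ?_) x) x <;> rfl
  have hself : ∀ x, G x x = 0 := by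
    intro x
    simp only [G, AlternatingMap.curryLeft_same, AlternatingMap.zero_apply]
  have haddl : ∀ x x' y, G (x + x') y = G x y + G x' y := by
    intro x x' y
    simp only [G, map_add, AlternatingMap.curryLeft_add, LinearMap.add_apply, AlternatingMap.add_apply]
  have haddr : ∀ x y y', G x (y + y') = G x y + G x y' := by
    intro x y y'
    simp only [G, map_add, AlternatingMap.add_apply]
  have hswap : ∀ x y, G x y = - G y x := by
    intro x y
    have := hself (x + y)
    rw [haddl, haddr, haddr, hself, hself] at this
    linear_combination this
  have hsmull : ∀ (c : R) x y, G (c • x) y = c * G x y := by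
    intro c x y
    simp only [G, map_smul, AlternatingMap.curryLeft_smul, LinearMap.smul_apply,
      AlternatingMap.smul_apply, smul_eq_mul]
  have hsumr : ∀ x y, G x y = ∑ r, x r * G (Pi.single r 1) y := by
    intro x y
    let L : V →ₗ[R] R := ⟨⟨fun x => G x y, fun x x' => haddl x x' y⟩, fun c x => hsmull c x y⟩
    change L x = ∑ r, x r * L (Pi.single r 1)
    conv_lhs => rw [pi_eq_sum_univ' x]
    simp [map_sum]
  have hexp : ∀ x y, G x y = ∑ r, ∑ q, x r * y q * G (Pi.single r 1) (Pi.single q 1) := by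
    intro x y
    rw [hsumr]
    refine Finset.sum_congr rfl fun r _ => ?_
    rw [hswap, hsumr, mul_neg, Finset.mul_sum, ← Finset.sum_neg_distrib]
    refine Finset.sum_congr rfl fun q _ => ?_
    rw [hswap (Pi.single q 1)]
    ring
  calc _ = ∑ i, ∑ r, ∑ q, N r (a i) * N q (b i) * G (Pi.single r 1) (Pi.single q 1) := by
        refine Finset.sum_congr rfl fun i _ => ?_
        rw [hdet, hexp]
    _ = ∑ r, ∑ q, (∑ i, N r (a i) * N q (b i)) * G (Pi.single r 1) (Pi.single q 1) := by
        rw [Finset.sum_comm]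
        refine Finset.sum_congr rfl fun r _ => ?_
        rw [Finset.sum_comm]
        refine Finset.sum_congr rfl fun q _ => ?_
        rw [Finset.sum_mul]
    _ = 0 := sum_symm_mul_alternating hN (fun _ => hself _) fun _ _ => hswap _ _

theorem maximalMinor_insert_insert {R E : Type*} [CommRing R] [LinearOrder E] {m : ℕ}
    (N : Matrix (Fin (m + 2)) E R) {S : Finset E} (hS : S.card = m) {a b : E} (ha : a ∉ S)
    (hb : b ∉ S) (hab : a < b) :
    (-1) ^ ((S.filter fun s => a < s).card + (S.filter fun s => b < s).card) *
        maximalMinor N (insert a (insert b S)) =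
      (N.submatrix id (Fin.cons a (Fin.cons b (S.orderEmbOfFin hS) : Fin (m + 1) → E) :
        Fin (m + 2) → E)).det := by
  have haT : a ∉ insert b S := by simp [ha, hab.ne]
  have hT : (insert b S).card = m + 1 := by rw [Finset.card_insert_of_notMem hb, hS]
  have hf : ((insert b S).filter fun s => s < a) = S.filter fun s => s < a := by
    rw [Finset.filter_insert, if_neg hab.not_gt]
  have h1 : (N.submatrix id (Fin.cons a ((insert b S).orderEmbOfFin hT) : Fin (m + 2) → E)).det =
      (-1) ^ (S.filter fun s => s < b).card *
        (N.submatrix id (Fin.cons a (Fin.cons b (S.orderEmbOfFin hS) : Fin (m + 1) → E) :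
          Fin (m + 2) → E)).det := by
    rw [det_submatrix_cons, det_submatrix_cons, Finset.mul_sum]
    refine Finset.sum_congr rfl fun r _ => ?_
    have h2 := maximalMinor_insert (N.submatrix r.succAbove id) hS hb
    rw [maximalMinor_of_card _ hT, Matrix.submatrix_submatrix, Matrix.submatrix_submatrix] at h2
    simp only [Function.comp_id, Function.id_comp] at h2
    rw [h2]
    ring
  have hsq : ∀ c : ℕ, ((-1 : R) ^ c) * (-1) ^ c = 1 := by
    intro c
    rw [← pow_add, ← two_mul, pow_mul]; simp
  rw [maximalMinor_insert N hT haT, hf, h1, pow_add, neg_one_pow_card_filter ha,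
    neg_one_pow_card_filter hb]
  set D := (N.submatrix id (Fin.cons a (Fin.cons b (S.orderEmbOfFin hS) : Fin (m + 1) → E) :
        Fin (m + 2) → E)).det
  calc _ = ((-1) ^ S.card * (-1) ^ S.card) * ((-1) ^ (S.filter fun s => s < a).card *
        (-1) ^ (S.filter fun s => s < a).card) * ((-1) ^ (S.filter fun s => s < b).card *
        (-1) ^ (S.filter fun s => s < b).card) * D := by ring
    _ = D := by rw [hsq, hsq, hsq]; ring

theorem sum_maximalMinor_insert_insert {R E ι : Type*} [CommRing R] [LinearOrder E] [Fintype ι]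
    {k : ℕ} (N : Matrix (Fin k) E R) (a b : ι → E) (hab : ∀ i, a i < b i)
    (hN : ∀ r q, ∑ i, N r (a i) * N q (b i) = ∑ i, N q (a i) * N r (b i))
    {S : Finset E} (hS : S.card + 2 = k) :
    ∑ i with a i ∉ S ∧ b i ∉ S,
      (-1) ^ ((S.filter fun s => a i < s).card + (S.filter fun s => b i < s).card) *
        maximalMinor N (insert (a i) (insert (b i) S)) = 0 := by
  obtain ⟨m, hm⟩ : ∃ m, S.card = m := ⟨_, rfl⟩
  obtain rfl : k = m + 2 := by omega
  rw [← sum_det_submatrix_cons_cons N a b (S.orderEmbOfFin hm) hN]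
  rw [Finset.sum_congr rfl fun i hi => maximalMinor_insert_insert N hm
    (Finset.mem_filter.1 hi).2.1 (Finset.mem_filter.1 hi).2.2 (hab i)]
  refine Finset.sum_subset (Finset.filter_subset _ _) fun i _ hi => ?_
  have hrange : ∀ x ∈ S, ∃ y, S.orderEmbOfFin hm y = x := fun x hx => by
    have : x ∈ Set.range (S.orderEmbOfFin hm) := by rw [Finset.range_orderEmbOfFin]; exact hx
    exact this
  by_cases ha : a i ∈ S
  · obtain ⟨x, hx⟩ := hrange _ ha
    refine Matrix.det_zero_of_column_eq (i := 0) (j := x.succ.succ) (Fin.succ_ne_zero _).symm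
      fun r => ?_
    simp [hx]
  · have hb : b i ∈ S := by simpa [ha] using hi
    obtain ⟨x, hx⟩ := hrange _ hb
    refine Matrix.det_zero_of_column_eq (i := Fin.succ 0) (j := x.succ.succ)
      ((Fin.succ_injective _).ne (Fin.succ_ne_zero _).symm) fun r => ?_
    simp only [Matrix.submatrix_apply, Fin.cons_succ, Fin.cons_zero, hx]

/-! ### Dual matrices and minors of block diagonal matrices, up to sign since valuations ignore
signs. -/

theorem det_submatrix_equiv_eq_or_neg {R α β E : Type*} [CommRing R] [Fintype α] [DecidableEq α]
    [Fintype β] [DecidableEq β] (N : Matrix α E R) (f : α → E) (g : β → E) (e₀ : β ≃ α)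
    (e : β ≃ α) (h : ∀ b, g b = f (e b)) :
    (N.submatrix id f).det = ((N.submatrix e₀ g).det) ∨
      (N.submatrix id f).det = - (N.submatrix e₀ g).det := by
  have h1 : N.submatrix e₀ g = ((N.submatrix id f).submatrix id (e₀.symm.trans e)).submatrix e₀ e₀ := by
    ext a b
    simp [h]
  rw [h1, Matrix.det_submatrix_equiv_self]
  have h2 := Matrix.det_permute' (e₀.symm.trans e) (N.submatrix id f)
  rw [h2]
  rcases Int.units_eq_one_or (Equiv.Perm.sign (e₀.symm.trans e)) with h3 | h3 <;> rw [h3] <;> simp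

theorem basis_sumExtend_inl {K V ι : Type*} [DivisionRing K] [AddCommGroup V] [Module K V]
    {v : ι → V} (hv : LinearIndependent K v) (i : ι) :
    Module.Basis.sumExtend hv (Sum.inl i) = v i := by
  rw [Module.Basis.sumExtend]
  rw [Module.Basis.reindex_apply, Module.Basis.extend_apply_self]
  rfl

/-- A matrix with independent rows has a dual matrix, whose rows are orthogonal to those of the
first matrix and whose maximal minors are the complementary ones. -/
theorem exists_dual_matrix {K : Type*} [Field K] {k n : ℕ} (M : Matrix (Fin k) (Fin n) K)
    (hM : LinearIndependent K M.row) :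
    ∃ (M' : Matrix (Fin (n - k)) (Fin n) K) (d : K), d ≠ 0 ∧ M * M'.transpose = 0 ∧
      ∀ (J : Finset (Fin n)) (hJ : J.card = k) (hJ' : Jᶜ.card = n - k),
        (M.submatrix id (J.orderEmbOfFin hJ)).det =
            d * (M'.submatrix id (Jᶜ.orderEmbOfFin hJ')).det ∨
          (M.submatrix id (J.orderEmbOfFin hJ)).det =
            -(d * (M'.submatrix id (Jᶜ.orderEmbOfFin hJ')).det) := by
  classical
  let b₀ := Module.Basis.sumExtend hM
  have : Finite (Fin k ⊕ Module.Basis.sumExtendIndex hM) := Module.Finite.finite_basis b₀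
  have : Finite (Module.Basis.sumExtendIndex hM) :=
    Finite.of_injective (Sum.inr : _ → Fin k ⊕ Module.Basis.sumExtendIndex hM) Sum.inr_injective
  have := Fintype.ofFinite (Module.Basis.sumExtendIndex hM)
  have hcard : k + Fintype.card (Module.Basis.sumExtendIndex hM) = n := by
    have := Module.finrank_eq_card_basis b₀
    simpa using this.symm
  let b := b₀.reindex (Equiv.sumCongr (Equiv.refl (Fin k))
    (Fintype.equivFinOfCardEq (n := n - k) (by omega :
      Fintype.card (Module.Basis.sumExtendIndex hM) = n - k)))
  have hb : ∀ i, b (Sum.inl i) = M i := by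
    intro i
    rw [Module.Basis.reindex_apply]
    exact basis_sumExtend_inl hM i
  let P : Matrix (Fin k ⊕ Fin (n - k)) (Fin n) K := ((Pi.basisFun K (Fin n)).toMatrix b).transpose
  let Q : Matrix (Fin n) (Fin k ⊕ Fin (n - k)) K := (b.toMatrix (Pi.basisFun K (Fin n))).transpose
  have hPQ : P * Q = 1 := by
    rw [← Matrix.transpose_mul, Module.Basis.toMatrix_mul_toMatrix_flip, Matrix.transpose_one]
  have hPM : ∀ i j, P (Sum.inl i) j = M i j := by
    intro i j
    simp [P, Module.Basis.toMatrix_apply, hb]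
  let e₀ : Fin k ⊕ Fin (n - k) ≃ Fin n :=
    Fintype.equivOfCardEq (by simp; omega)
  -- `P` has the rows of `M`, completed to a basis, and `Q` is its inverse; the dual matrix consists
  -- of the last columns of `Q`. The arbitrary bijection `e₀` makes `P` square and only affects the
  -- sign of the common factor.
  refine ⟨Matrix.of fun x j => Q j (Sum.inr x), (P.submatrix id e₀).det, ?_, ?_, ?_⟩
  · have h1 : P.submatrix id e₀ * Q.submatrix e₀ id = 1 := by
      rw [← Matrix.submatrix_mul P Q id e₀ id e₀.bijective, hPQ, Matrix.submatrix_id_id]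
    exact (IsUnit.of_mul_eq_one _ (by rw [← Matrix.det_mul, h1, Matrix.det_one])).ne_zero
  · ext i x
    have := congrFun (congrFun hPQ (Sum.inl i)) (Sum.inr x)
    rw [Matrix.mul_apply] at this ⊢
    simpa [hPM] using this
  · intro J hJ hJ'
    let eJ : Fin k ⊕ Fin (n - k) ≃ Fin n := finSumEquivOfFinset hJ hJ'
    have h1 : P.submatrix id eJ * Q.submatrix eJ id = 1 := by
      rw [← Matrix.submatrix_mul P Q id eJ id eJ.bijective, hPQ, Matrix.submatrix_id_id]
    let Q' := Q.submatrix eJ id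
    let P' := P.submatrix id eJ
    -- Jacobi's identity for complementary minors of inverse matrices: determinants of both sides
    -- give det P' · det Q'₂₂ = det P'₁₁.
    have h2 : P' * Matrix.fromBlocks 1 Q'.toBlocks₁₂ 0 Q'.toBlocks₂₂ =
        Matrix.fromBlocks P'.toBlocks₁₁ 0 P'.toBlocks₂₁ 1 := by
      have h3 : Matrix.fromBlocks P'.toBlocks₁₁ P'.toBlocks₁₂ P'.toBlocks₂₁ P'.toBlocks₂₂ *
          Matrix.fromBlocks Q'.toBlocks₁₁ Q'.toBlocks₁₂ Q'.toBlocks₂₁ Q'.toBlocks₂₂ =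
          Matrix.fromBlocks 1 0 0 1 := by
        rw [Matrix.fromBlocks_toBlocks, Matrix.fromBlocks_toBlocks, Matrix.fromBlocks_one]
        exact h1
      rw [Matrix.fromBlocks_multiply, Matrix.fromBlocks_inj] at h3
      conv_lhs => rw [← Matrix.fromBlocks_toBlocks P']
      rw [Matrix.fromBlocks_multiply, h3.2.1, h3.2.2.2]
      simp
    have h4 := congrArg Matrix.det h2
    rw [Matrix.det_mul, Matrix.det_fromBlocks_zero₂₁, Matrix.det_fromBlocks_zero₁₂, Matrix.det_one,
      Matrix.det_one, one_mul, mul_one] at h4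
    have h5 : P'.toBlocks₁₁ = M.submatrix id (J.orderEmbOfFin hJ) := by
      ext i j
      simp [P', Matrix.toBlocks₁₁, eJ, hPM]
    have h6 : Q'.toBlocks₂₂ = ((Matrix.of fun x j => Q j (Sum.inr x)).submatrix id
        (Jᶜ.orderEmbOfFin hJ')).transpose := by
      ext i j
      simp [Q', Matrix.toBlocks₂₂, eJ]
    rw [h5, h6, Matrix.det_transpose] at h4
    rw [← h4]
    have h7 := det_submatrix_equiv_eq_or_neg P eJ e₀ (Equiv.refl _) (e₀.trans eJ.symm) (by simp)
    rw [Equiv.coe_refl] at h7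
    rcases h7 with h7 | h7
    · left
      change (P.submatrix id eJ).det * _ = _
      rw [h7]
    · right
      change (P.submatrix id eJ).det * _ = _
      rw [h7, neg_mul]

theorem exists_equiv_of_range_eq {α β E : Type*} {f : α → E} {g : β → E} (hf : Function.Injective f)
    (hg : Function.Injective g) (h : Set.range g = Set.range f) : ∃ e : β ≃ α, ∀ b, g b = f (e b) := by
  refine ⟨(Equiv.ofInjective g hg).trans ((Equiv.setCongr h).trans (Equiv.ofInjective f hf).symm),
    fun b => ?_⟩
  simp [Equiv.apply_ofInjective_symm]

/-- A nonzero term of the Leibniz formula matches the rows of the first block with exactly the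
columns chosen on the left. -/
theorem det_fromBlocks_submatrix_eq_zero {R α β E₁ E₂ : Type*} [CommRing R] [Fintype α] [DecidableEq α]
    [Fintype β] [DecidableEq β] [DecidableEq E₁] [DecidableEq E₂] (M₁ : Matrix α E₁ R)
    (M₂ : Matrix β E₂ R) {g : α ⊕ β → E₁ ⊕ E₂} (hg : Function.Injective g)
    (h : (Finset.univ.image g).toLeft.card ≠ Fintype.card α) :
    ((Matrix.fromBlocks M₁ 0 0 M₂).submatrix id g).det = 0 := by
  rw [Matrix.det_apply]
  refine Finset.sum_eq_zero fun σ _ => ?_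
  suffices ∃ x, (Matrix.fromBlocks M₁ 0 0 M₂) (σ x) (g x) = 0 by
    obtain ⟨x, hx⟩ := this
    rw [Finset.prod_eq_zero (Finset.mem_univ x) (by simpa using hx), smul_zero]
  by_contra hcon
  push Not at hcon
  apply h
  have hiff : ∀ x, (σ x).isLeft = (g x).isLeft := by
    intro x
    have := hcon x
    rcases hs : σ x with a | a <;> rcases hg' : g x with c | c <;> simp [hs, hg'] at this ⊢
  have h1 : (Finset.univ.image g).toLeft.map Function.Embedding.inl =
      (Finset.univ.filter fun x => (g x).isLeft).map ⟨g, hg⟩ := by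
    ext (c | c)
    · simp only [Finset.mem_map, Finset.mem_toLeft, Finset.mem_image, Finset.mem_univ, true_and,
        Function.Embedding.inl_apply, Finset.mem_filter, Function.Embedding.coeFn_mk]
      constructor
      · rintro ⟨a, ⟨x, hx⟩, ha⟩
        exact ⟨x, by simp [hx], by rw [hx, ha]⟩
      · rintro ⟨x, -, hx⟩
        exact ⟨c, ⟨x, hx⟩, rfl⟩
    · simp only [Finset.mem_map, Finset.mem_toLeft, Finset.mem_image, Finset.mem_univ, true_and,
        Function.Embedding.inl_apply, Finset.mem_filter, Function.Embedding.coeFn_mk]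
      constructor
      · rintro ⟨a, -, ha⟩
        cases ha
      · rintro ⟨x, hx, hx'⟩
        rw [hx'] at hx
        cases hx
  have h2 : (Finset.univ.filter fun x => (g x).isLeft) =
      ((Finset.univ : Finset α).map Function.Embedding.inl).map σ.symm.toEmbedding := by
    ext x
    simp only [Finset.mem_filter, Finset.mem_univ, true_and, Finset.mem_map, ← hiff,
      Function.Embedding.inl_apply, Equiv.coe_toEmbedding]
    constructor
    · intro hx
      rcases hs : σ x with a | a
      · exact ⟨Sum.inl a, ⟨a, rfl⟩, by rw [← hs, Equiv.symm_apply_apply]⟩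
      · simp [hs] at hx
    · rintro ⟨_, ⟨a, rfl⟩, rfl⟩
      simp
  rw [← Finset.card_map Function.Embedding.inl, h1, Finset.card_map, h2, Finset.card_map,
    Finset.card_map, Finset.card_univ]

/-- The block diagonal matrix of two matrices with `n` columns and `n` rows in total, with its
columns in the order `1 < ⋯ < n < 1̄ < ⋯ < n̄`. -/
noncomputable def blockDiagonalLex {R : Type*} [Zero R] {k m n : ℕ} (e : Fin n ≃ Fin k ⊕ Fin m)
    (M₁ : Matrix (Fin k) (Fin n) R) (M₂ : Matrix (Fin m) (Fin n) R) :
    Matrix (Fin n) (Lex (Fin n ⊕ Fin n)) R :=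
  (Matrix.fromBlocks M₁ 0 0 M₂).submatrix e ofLex

/-- The Plücker coordinate of a set of columns indexed by `[2n]`. -/
noncomputable def lexMinor {R : Type*} [CommRing R] {k n : ℕ}
    (N : Matrix (Fin k) (Lex (Fin n ⊕ Fin n)) R) (J : Finset (Fin n ⊕ Fin n)) : R :=
  maximalMinor N (J.map toLex.toEmbedding)

theorem exists_injective_lexMinor {R : Type*} [CommRing R] {n : ℕ}
    (N : Matrix (Fin n) (Lex (Fin n ⊕ Fin n)) R) {J : Finset (Fin n ⊕ Fin n)} (hJ : J.card = n) :
    ∃ f : Fin n → Fin n ⊕ Fin n, Function.Injective f ∧ Finset.univ.image f = J ∧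
      lexMinor N J = (N.submatrix id (toLex ∘ f)).det := by
  have hJ' : (J.map toLex.toEmbedding).card = n := by rw [Finset.card_map, hJ]
  refine ⟨ofLex ∘ (J.map toLex.toEmbedding).orderEmbOfFin hJ',
    ofLex.injective.comp (RelEmbedding.injective _), ?_, ?_⟩
  · ext x
    have := Set.ext_iff.1 (Finset.range_orderEmbOfFin _ hJ') (toLex x)
    rw [Set.mem_range] at this
    simpa [← ofLex.injective.eq_iff, -Finset.range_orderEmbOfFin] using this
  · rw [lexMinor, maximalMinor_of_card N hJ']
    rfl

theorem lexMinor_blockDiagonalLex_eq_zero {R : Type*} [CommRing R] {k m n : ℕ}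
    (e : Fin n ≃ Fin k ⊕ Fin m) (M₁ : Matrix (Fin k) (Fin n) R) (M₂ : Matrix (Fin m) (Fin n) R)
    {J : Finset (Fin n ⊕ Fin n)} (hJ : J.toLeft.card ≠ k) :
    lexMinor (blockDiagonalLex e M₁ M₂) J = 0 := by
  by_cases hJn : J.card = n
  · obtain ⟨f, hf, hfJ, h⟩ := exists_injective_lexMinor (blockDiagonalLex e M₁ M₂) hJn
    rw [h, ← Matrix.det_submatrix_equiv_self e.symm]
    have h1 : ((blockDiagonalLex e M₁ M₂).submatrix id (toLex ∘ f)).submatrix e.symm e.symm =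
        (Matrix.fromBlocks M₁ 0 0 M₂).submatrix id (f ∘ e.symm) := by
      ext a b
      simp [blockDiagonalLex]
    rw [h1]
    refine det_fromBlocks_submatrix_eq_zero M₁ M₂ (hf.comp e.symm.injective) ?_
    have h2 : Finset.univ.image (f ∘ e.symm) = J := by
      rw [← Finset.image_image, Finset.image_univ_equiv, hfJ]
    rwa [h2, Fintype.card_fin]
  · rw [lexMinor, maximalMinor, dif_neg]
    rwa [Finset.card_map]

theorem lexMinor_blockDiagonalLex {R : Type*} [CommRing R] {k m n : ℕ}
    (e : Fin n ≃ Fin k ⊕ Fin m) (M₁ : Matrix (Fin k) (Fin n) R) (M₂ : Matrix (Fin m) (Fin n) R)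
    {J : Finset (Fin n ⊕ Fin n)} (h₁ : J.toLeft.card = k) (h₂ : J.toRight.card = m) :
    lexMinor (blockDiagonalLex e M₁ M₂) J =
        (M₁.submatrix id (J.toLeft.orderEmbOfFin h₁)).det *
          (M₂.submatrix id (J.toRight.orderEmbOfFin h₂)).det ∨
      lexMinor (blockDiagonalLex e M₁ M₂) J =
        -((M₁.submatrix id (J.toLeft.orderEmbOfFin h₁)).det *
          (M₂.submatrix id (J.toRight.orderEmbOfFin h₂)).det) := by
  have hn : n = k + m := by simpa using Fintype.card_congr e
  have hJn : J.card = n := by rw [← Finset.card_toLeft_add_card_toRight]; omega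
  obtain ⟨f, hf, hfJ, h⟩ := exists_injective_lexMinor (blockDiagonalLex e M₁ M₂) hJn
  let g : Fin k ⊕ Fin m → Fin n ⊕ Fin n :=
    Sum.map (J.toLeft.orderEmbOfFin h₁) (J.toRight.orderEmbOfFin h₂)
  have hg : Function.Injective g :=
    Sum.map_injective.2 ⟨RelEmbedding.injective _, RelEmbedding.injective _⟩
  have hrange : Set.range g = Set.range f := by
    have h3 : Set.range f = J := by rw [← hfJ]; simp
    rw [h3]
    ext (x | x)
    · have := Set.ext_iff.1 (Finset.range_orderEmbOfFin J.toLeft h₁) x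
      rw [Set.mem_range] at this
      simpa [g] using this
    · have := Set.ext_iff.1 (Finset.range_orderEmbOfFin J.toRight h₂) x
      rw [Set.mem_range] at this
      simpa [g] using this
  obtain ⟨e', he'⟩ := exists_equiv_of_range_eq hf hg hrange
  have h4 := det_submatrix_equiv_eq_or_neg (blockDiagonalLex e M₁ M₂) (toLex ∘ f) (toLex ∘ g)
    e.symm e' (by intro b; simp [he'])
  have h5 : (blockDiagonalLex e M₁ M₂).submatrix e.symm (toLex ∘ g) =
      Matrix.fromBlocks (M₁.submatrix id (J.toLeft.orderEmbOfFin h₁)) 0 0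
        (M₂.submatrix id (J.toRight.orderEmbOfFin h₂)) := by
    ext (a | a) (b | b) <;> simp [blockDiagonalLex, g]
  rwa [← h, h5, Matrix.det_fromBlocks_zero₂₁] at h4

theorem lexMinor_plucker {R : Type*} [CommRing R] {k n : ℕ}
    (N : Matrix (Fin k) (Lex (Fin n ⊕ Fin n)) R) {S T : Finset (Fin n ⊕ Fin n)}
    (hS : S.card + 1 = k) (hT : T.card = k + 1) :
    ∑ i ∈ T \ S, (-1) ^ ((T.filter fun t => toLex t < toLex i).card +
        (S.filter fun s => toLex i < toLex s).card) *
      (lexMinor N (T.erase i) * lexMinor N (insert i S)) = 0 := by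
  have := maximalMinor_plucker N (S := S.map toLex.toEmbedding) (T := T.map toLex.toEmbedding)
    (by rwa [Finset.card_map]) (by rwa [Finset.card_map])
  rw [← Finset.map_sdiff, Finset.sum_map] at this
  rw [← this]
  refine Finset.sum_congr rfl fun i _ => ?_
  rw [Finset.filter_map, Finset.filter_map, Finset.card_map, Finset.card_map, lexMinor, lexMinor,
    Finset.map_erase, Finset.map_insert]
  rfl

theorem lexMinor_symplectic {R : Type*} [CommRing R] {k n : ℕ}
    (N : Matrix (Fin k) (Lex (Fin n ⊕ Fin n)) R)
    (hN : ∀ r q, ∑ i, N r (toLex (Sum.inl i)) * N q (toLex (Sum.inr i)) =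
      ∑ i, N q (toLex (Sum.inl i)) * N r (toLex (Sum.inr i)))
    {S : Finset (Fin n ⊕ Fin n)} (hS : S.card + 2 = k) :
    ∑ i ∈ Finset.univ.filter fun i : Fin n => Sum.inl i ∉ S ∧ Sum.inr i ∉ S,
      (-1) ^ ((S.filter fun s => toLex (Sum.inl i) < toLex s).card +
        (S.filter fun s => toLex (Sum.inr i) < toLex s).card) *
      lexMinor N (insert (Sum.inl i) (insert (Sum.inr i) S)) = 0 := by
  have := sum_maximalMinor_insert_insert N (fun i : Fin n => toLex (Sum.inl i))
    (fun i : Fin n => toLex (Sum.inr i)) (fun i => Sum.Lex.inl_lt_inr _ _) hN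
    (S := S.map toLex.toEmbedding) (by rwa [Finset.card_map])
  rw [← this]
  refine Finset.sum_congr ?_ fun i _ => ?_
  · refine Finset.filter_congr fun i _ => ?_
    simp
  · rw [Finset.filter_map, Finset.filter_map, Finset.card_map, Finset.card_map, lexMinor,
      Finset.map_insert, Finset.map_insert]
    rfl

theorem blockDiagonalLex_isotropic {R : Type*} [CommRing R] {k m n : ℕ}
    (e : Fin n ≃ Fin k ⊕ Fin m) {M₁ : Matrix (Fin k) (Fin n) R} {M₂ : Matrix (Fin m) (Fin n) R}
    (h : M₁ * M₂.transpose = 0) (r q : Fin n) :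
    ∑ i, blockDiagonalLex e M₁ M₂ r (toLex (Sum.inl i)) *
        blockDiagonalLex e M₁ M₂ q (toLex (Sum.inr i)) = 0 := by
  simp only [blockDiagonalLex, Matrix.submatrix_apply, ofLex_toLex]
  rcases e r with a | a <;> rcases e q with b | b <;> simp
  have := congrFun (congrFun h a) b
  simpa [Matrix.mul_apply] using this

/-! ### Realizable valuated matroids and the tropical symplectic Grassmannian. -/

theorem AddValuation.map_prod_pow {K ι : Type*} [Field K] (v : AddValuation K TropNum) (s : Finset ι)
    (x : ι → K) (m : ι → ℕ) : v (∏ i ∈ s, x i ^ m i) = ∑ i ∈ s, m i • v (x i) := by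
  classical
  induction s using Finset.induction_on with
  | empty => simp
  | insert a s ha ih => rw [Finset.prod_insert ha, Finset.sum_insert ha, v.map_mul, v.map_pow, ih]

/-- If all homogeneous parts of `f` vanish at `x`, then the tropical hypersurface of `f` contains
the valuation of `x`, shifted by a real constant. -/
theorem inTropHypersurface_of_homogeneous_zero {K σ : Type*} [Field K] (v : AddValuation K TropNum)
    {f : MvPolynomial σ K} {x : σ → K} {w : σ → TropNum} {c : ℝ}
    (hw : ∀ s, w s = v (x s) + (c : TropNum))
    (hf : MvPolynomial.eval₂Hom Polynomial.C (fun s => Polynomial.C (x s) * Polynomial.X) f = 0) :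
    InTropHypersurface v f w := by
  classical
  let y : (σ →₀ ℕ) → K := fun a => f.coeff a * ∏ s ∈ a.support, x s ^ a s
  have hval : ∀ a : σ →₀ ℕ, (v (f.coeff a) + a.sum fun s m => m • w s) =
      v (y a) + (a.degree : ℕ) • (c : TropNum) := by
    intro a
    simp only [y, v.map_mul, v.map_prod_pow, Finsupp.sum, hw, smul_add, Finset.sum_add_distrib,
      Finsupp.degree_apply, Finset.sum_smul, add_assoc]
  -- In `hf` the power of the variable records the degree. Terms must be compared within one degree
  -- `d`, where the shift adds the same `d` copies of `c` to each; terms that sum to zero have no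
  -- strict unique minimum.
  have hzero : ∀ d : ℕ, ∑ a ∈ f.support with a.degree = d, y a = 0 := by
    intro d
    have h := congrArg (fun p => Polynomial.coeff p d) hf
    rw [Finset.sum_filter]
    simp only [MvPolynomial.coe_eval₂Hom, MvPolynomial.eval₂_eq, Polynomial.finsetSum_coeff,
      Polynomial.coeff_zero, mul_pow, Finset.prod_mul_distrib, Finset.prod_pow_eq_pow_sum,
      ← Polynomial.C_pow, ← map_prod, ← mul_assoc, ← map_mul, Polynomial.coeff_C_mul_X_pow] at h
    refine (Finset.sum_congr rfl fun a _ => ?_).trans h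
    simp only [Finsupp.degree_apply, y, eq_comm]
  refine (minTwice_iff _ _).2 fun a ha hne => ?_
  by_contra hcon
  push Not at hcon
  simp only [hval] at hne hcon
  rw [Ne, WithTop.add_eq_top, not_or] at hne
  have h1 : ∀ b ∈ (f.support.filter fun b => b.degree = a.degree).erase a, v (y a) < v (y b) := by
    intro b hb
    obtain ⟨hba, hb'⟩ := Finset.mem_erase.1 hb
    obtain ⟨hbf, hdeg⟩ := Finset.mem_filter.1 hb'
    have := hcon b hbf hba
    rw [hdeg] at this
    exact lt_of_add_lt_add_right this
  have h2 := v.map_lt_sum hne.1 h1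
  have h3 := Finset.add_sum_erase (f.support.filter fun b => b.degree = a.degree) y
    (Finset.mem_filter.2 ⟨ha, rfl⟩)
  rw [hzero, add_comm] at h3
  rw [eq_neg_of_add_eq_zero_left h3, v.map_neg] at h2
  exact lt_irrefl _ h2

theorem pluckerSymplecticIdeal_le_ker {K : Type*} [Field K] {n k m : ℕ}
    (e : Fin n ≃ Fin k ⊕ Fin m) {M₁ : Matrix (Fin k) (Fin n) K} {M₂ : Matrix (Fin m) (Fin n) K}
    (h : M₁ * M₂.transpose = 0) {f : MvPolynomial {J : Finset (Fin n ⊕ Fin n) // J.card = n} K}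
    (hf : f ∈ pluckerSymplecticIdeal K n n) :
    MvPolynomial.eval₂Hom Polynomial.C (fun J : {J : Finset (Fin n ⊕ Fin n) // J.card = n} =>
      Polynomial.C (lexMinor (blockDiagonalLex e M₁ M₂) J.1) * Polynomial.X) f = 0 := by
  set N := blockDiagonalLex e M₁ M₂
  set φ := MvPolynomial.eval₂Hom Polynomial.C
    (fun J : {J : Finset (Fin n ⊕ Fin n) // J.card = n} =>
      Polynomial.C (lexMinor N J.1) * Polynomial.X) with hφ
  have hvar : ∀ J : Finset (Fin n ⊕ Fin n), φ (pluckerVar K n J) =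
      Polynomial.C (lexMinor N J) * Polynomial.X := by
    intro J
    by_cases hJ : J.card = n
    · rw [pluckerVar, dif_pos hJ, hφ, MvPolynomial.eval₂Hom_X']
    · rw [pluckerVar, dif_neg hJ, map_zero, lexMinor, maximalMinor, dif_neg, Polynomial.C_0, zero_mul]
      rwa [Finset.card_map]
  suffices pluckerSymplecticIdeal K n n ≤ RingHom.ker φ from this hf
  rw [pluckerSymplecticIdeal, Ideal.span_le]
  rintro f (⟨S, T, hS, hT, rfl⟩ | ⟨S, hS, rfl⟩)
  · have h1 := congrArg Polynomial.C (lexMinor_plucker N hS hT)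
    simp only [SetLike.mem_coe, RingHom.mem_ker, pluckerRelation, map_sum, map_mul, map_pow, map_neg,
      map_one, hvar, map_zero] at h1 ⊢
    rw [← zero_mul (Polynomial.X ^ 2 : Polynomial K), ← h1, Finset.sum_mul]
    exact Finset.sum_congr rfl fun i _ => by ring
  · have h0 := blockDiagonalLex_isotropic e h
    have hiso : ∀ r q, ∑ i, N r (toLex (Sum.inl i)) * N q (toLex (Sum.inr i)) =
        ∑ i, N q (toLex (Sum.inl i)) * N r (toLex (Sum.inr i)) := fun r q =>
      (h0 r q).trans (h0 q r).symm
    have h1 := congrArg Polynomial.C (lexMinor_symplectic N hiso hS)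
    simp only [SetLike.mem_coe, RingHom.mem_ker, symplecticRelation, map_sum, map_mul, map_pow,
      map_neg, map_one, hvar, map_zero] at h1 ⊢
    rw [← zero_mul (Polynomial.X : Polynomial K), ← h1, Finset.sum_mul]
    exact Finset.sum_congr rfl fun i _ => by ring

theorem directSumVM_dualVM_mem_tropSymplecticGrOver {n k : ℕ} {μ : Finset (Fin n) → TropNum}
    (hμ : IsTropProjVector k μ) {K : Type*} [Field K] (v : AddValuation K TropNum)
    (h : IsRealizableVM v k μ) : directSumVM μ (dualVM μ) ∈ tropSymplecticGrOver v n n := by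
  have hk := hμ.rank_le
  obtain ⟨M, hM, c, hc⟩ := h
  obtain ⟨M', d, hd, hort, hdual⟩ := exists_dual_matrix M hM
  let e : Fin n ≃ Fin k ⊕ Fin (n - k) := Fintype.equivOfCardEq (by simp; omega)
  have hproj : IsTropProjVector n (directSumVM μ (dualVM μ)) := by
    have := hμ.directSum hμ.dual
    rwa [Nat.add_sub_cancel' hk] at this
  refine ⟨hproj, fun f hf => ?_⟩
  have hvd : v d ≠ ⊤ := v.ne_top_iff.2 hd
  have hor : ∀ x y : K, x = y ∨ x = -y → v x = v y := by
    rintro x y (rfl | rfl)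
    · rfl
    · exact v.map_neg y
  -- Each of the two values of `μ` contributes `c`; `v d` arises from replacing a minor of `M` by
  -- the complementary minor of `M'`.
  refine inTropHypersurface_of_homogeneous_zero v (c := (v d).untop hvd + c + c) (fun J => ?_)
    (pluckerSymplecticIdeal_le_ker e hort hf)
  have hJ : J.1.toLeft.card + J.1.toRight.card = n := by
    rw [Finset.card_toLeft_add_card_toRight, J.2]
  by_cases h₁ : J.1.toLeft.card = k
  · have h₂ : J.1.toRight.card = n - k := by omega
    have h₃ : J.1.toRightᶜ.card = k := by
      rw [Finset.card_compl, Fintype.card_fin]; omega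
    have h₄ : J.1.toRightᶜᶜ.card = n - k := by rw [compl_compl, h₂]
    rw [hor _ _ (lexMinor_blockDiagonalLex e M M' h₁ h₂), v.map_mul, directSumVM, dualVM, hc _ h₁,
      hc _ h₃, hor _ _ (hdual _ h₃ h₄), v.map_mul]
    simp only [compl_compl]
    push_cast
    rw [WithTop.coe_untop]
    ac_rfl
  · rw [lexMinor_blockDiagonalLex_eq_zero e M M' h₁, v.map_zero, top_add, directSumVM, hμ.1 _ h₁,
      top_add]

/-! ### Independence of the valued field. -/

/-- A family `b` in a field extension `K` of `F` that is orthogonal for `v`, where nonzero elements of `F`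
have valuation `0`. -/
def IsValuationOrthogonal (F : Type*) {K : Type*} [Field F] [Field K] [Algebra F K]
    (v : AddValuation K TropNum) {ι : Type*} [Fintype ι] (b : ι → K) : Prop :=
  ∀ x : ι → F, ∀ i, x i ≠ 0 → v (∑ j, x j • b j) ≤ v (b i)

theorem AddValuation.smul_of_trivial {F K : Type*} [Field F] [Field K] [Algebra F K]
    (v : AddValuation K TropNum) (hv : ∀ x : F, x ≠ 0 → v (algebraMap F K x) = 0) {x : F} (hx : x ≠ 0)
    (y : K) : v (x • y) = v y := by
  rw [Algebra.smul_def, v.map_mul, hv x hx, zero_add]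

theorem AddValuation.le_smul_of_trivial {F K : Type*} [Field F] [Field K] [Algebra F K]
    (v : AddValuation K TropNum) (hv : ∀ x : F, x ≠ 0 → v (algebraMap F K x) = 0) (x : F)
    (y : K) : v y ≤ v (x • y) := by
  by_cases hx : x = 0
  · simp [hx]
  · rw [v.smul_of_trivial hv hx]

/-- Gram–Schmidt for valuations: a new element is replaced by its difference from a best
approximation in the span constructed so far. -/
theorem exists_valuationOrthogonal {F K : Type*} [Field F] [Field K] [Algebra F K]
    (v : AddValuation K TropNum) (hv : ∀ x : F, x ≠ 0 → v (algebraMap F K x) = 0) (s : Finset K) :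
    ∃ (m : ℕ) (b : Fin m → K), IsValuationOrthogonal F v b ∧ (∀ i, b i ≠ 0) ∧
      (s : Set K) ⊆ Submodule.span F (Set.range b) := by
  classical
  induction s using Finset.induction_on with
  | empty => exact ⟨0, Fin.elim0, fun _ i => i.elim0, fun i => i.elim0, by simp⟩
  | insert d s _ ih =>
    obtain ⟨m, b, hb, hb0, hs⟩ := ih
    by_cases hd : d ∈ Submodule.span F (Set.range b)
    · refine ⟨m, b, hb, hb0, ?_⟩
      rw [Finset.coe_insert]
      exact Set.insert_subset hd hs
    -- a best approximation of `d` by the span of `b`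
    have hVval : ∀ u ∈ Submodule.span F (Set.range b), u ≠ 0 → ∃ i, v u = v (b i) := by
      intro u hu hu0
      obtain ⟨x, rfl⟩ := (Submodule.mem_span_range_iff_exists_fun F).1 hu
      by_contra hcon
      push Not at hcon
      have hlt : ∀ i, x i ≠ 0 → v (∑ j, x j • b j) < v (b i) := fun i hi =>
        lt_of_le_of_ne (hb x i hi) (hcon i)
      refine lt_irrefl _ (v.map_lt_sum (s := Finset.univ) (f := fun j => x j • b j)
        (v.ne_top_iff.2 hu0) fun i _ => ?_)
      by_cases hi : x i = 0
      · rw [hi, zero_smul, v.map_zero]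
        exact lt_top_iff_ne_top.2 (v.ne_top_iff.2 hu0)
      · rw [v.smul_of_trivial hv hi]
        exact hlt i hi
    obtain ⟨u, hu, hmax⟩ : ∃ u ∈ Submodule.span F (Set.range b),
        ∀ u' ∈ Submodule.span F (Set.range b), v (d - u') ≤ v (d - u) := by
      by_contra hcon
      push Not at hcon
      -- If every `u` could be improved by some `u'`, then v(d - u) = v(u' - u) would be one of the
      -- finitely many v(b_i), so a largest value would exist after all.
      have hsub : (fun u => v (d - u)) '' (Submodule.span F (Set.range b) : Set K) ⊆
          Set.range fun i => v (b i) := by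
        rintro _ ⟨u, hu, rfl⟩
        obtain ⟨u', hu', hlt⟩ := hcon u hu
        have h1 := v.map_sub_eq_of_lt_left hlt
        rw [sub_sub_sub_cancel_left] at h1
        obtain ⟨i, hi⟩ := hVval (u' - u) (Submodule.sub_mem _ hu' hu) (by
          rw [sub_ne_zero]
          rintro rfl
          exact lt_irrefl _ hlt)
        exact ⟨i, hi.symm.trans h1⟩
      obtain ⟨_, ⟨u, hu, rfl⟩, hmax⟩ := Set.exists_max_image _ id ((Set.finite_range _).subset hsub)
        ⟨_, 0, Submodule.zero_mem _, rfl⟩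
      obtain ⟨u', hu', hlt⟩ := hcon u hu
      exact absurd (hmax _ ⟨u', hu', rfl⟩) hlt.not_ge
    have hbmem : ∀ x : Fin m → F, ∑ j, x j • b j ∈ Submodule.span F (Set.range b) := fun x =>
      Submodule.sum_mem _ fun j _ => Submodule.smul_mem _ _ (Submodule.subset_span ⟨j, rfl⟩)
    refine ⟨m + 1, Fin.cons (d - u) b, ?_, ?_, ?_⟩
    · intro x i hi
      rw [Fin.sum_univ_succ]
      simp only [Fin.cons_zero, Fin.cons_succ]
      set y := ∑ j : Fin m, x j.succ • b j with hy
      have hymem : y ∈ Submodule.span F (Set.range b) := hbmem fun j => x j.succ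
      by_cases hx0 : x 0 = 0
      · rw [hx0, zero_smul, zero_add]
        induction i using Fin.cases with
        | zero => exact absurd hx0 hi
        | succ i => exact hb (fun j => x j.succ) i hi
      · have h1 : v (x 0 • (d - u) + y) ≤ v (d - u) := by
          have h2 : x 0 • (d - u) + y = x 0 • (d - (u - (x 0)⁻¹ • y)) := by
            rw [sub_sub_eq_add_sub, add_sub_right_comm, smul_add, smul_inv_smul₀ hx0]
          rw [h2, v.smul_of_trivial hv hx0]
          exact hmax _ (Submodule.sub_mem _ hu (Submodule.smul_mem _ _ hymem))
        induction i using Fin.cases with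
        | zero => exact h1
        | succ i =>
          have h3 : v y ≤ v (b i) := hb (fun j => x j.succ) i hi
          by_contra hcon
          have hcon' : v (b i) < v (x 0 • (d - u) + y) := not_le.1 hcon
          -- If the sum had valuation above v(b_i) ≥ v(y), then v(d - u) would equal v(y), contrary
          -- to the bound by v(d - u) just proved.
          have h4 := v.map_sub_eq_of_lt_right (h3.trans_lt hcon')
          rw [add_sub_cancel_right, v.smul_of_trivial hv hx0] at h4
          rw [h4] at h1
          exact absurd (h1.trans h3) hcon
    · intro i
      induction i using Fin.cases with
      | zero =>
        rw [Fin.cons_zero, sub_ne_zero]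
        rintro rfl
        exact hd hu
      | succ i => exact hb0 i
    · have hle : Submodule.span F (Set.range b) ≤
          Submodule.span F (Set.range (Fin.cons (d - u) b : Fin (m + 1) → K)) :=
        Submodule.span_mono fun _ ⟨i, hi⟩ => ⟨i.succ, hi⟩
      rw [Finset.coe_insert]
      refine Set.insert_subset ?_ (hs.trans hle)
      have h1 : d - u ∈ Submodule.span F (Set.range (Fin.cons (d - u) b : Fin (m + 1) → K)) :=
        Submodule.subset_span ⟨0, rfl⟩
      simpa using Submodule.add_mem _ h1 (hle hu)

/-- Expanding the scalars in an orthogonal family gives f = ∑ b_j h_j with every h_j in `I`. The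
valuation of a coefficient of `f` is the least v(b_j) over the h_j that contain the monomial, so a
second monomial of a suitable h_j serves for `f` too, and orthogonality keeps it from cancelling. -/
theorem inTropHypersurface_of_mem_span {F K σ : Type*} [Field F] [Field K] [Algebra F K]
    (v : AddValuation K TropNum) (hv : ∀ x : F, x ≠ 0 → v (algebraMap F K x) = 0)
    {I : Ideal (MvPolynomial σ F)} {w : σ → TropNum}
    (hI : ∀ g ∈ I, MinTwice g.support fun a => a.sum fun s m => m • w s)
    {f : MvPolynomial σ K}
    (hf : f ∈ Submodule.span K (MvPolynomial.map (algebraMap F K) '' (I : Set (MvPolynomial σ F)))) :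
    InTropHypersurface v f w := by
  classical
  obtain ⟨l, c, g, rfl⟩ := Submodule.mem_span_set'.1 hf
  choose g' hg'I hg' using fun i => (g i).2
  obtain ⟨m, b, hb, hb0, hspan⟩ := exists_valuationOrthogonal v hv (Finset.univ.image c)
  have hc : ∀ i, ∃ x : Fin m → F, ∑ j, x j • b j = c i := fun i =>
    (Submodule.mem_span_range_iff_exists_fun F).1 (hspan (by simp))
  choose x hx using hc
  let h : Fin m → MvPolynomial σ F := fun j => ∑ i, MvPolynomial.C (x i j) * g' i
  have hhI : ∀ j, h j ∈ I := fun j => Ideal.sum_mem _ fun i _ => Ideal.mul_mem_left _ _ (hg'I i)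
  have hcoeff : ∀ a, MvPolynomial.coeff a (∑ i, c i • (g i : MvPolynomial σ K)) =
      ∑ j, (h j).coeff a • b j := by
    intro a
    simp only [MvPolynomial.coeff_sum, MvPolynomial.coeff_smul, ← hg', MvPolynomial.coeff_map, ← hx,
      h, MvPolynomial.coeff_C_mul, Finset.sum_smul, smul_eq_mul]
    rw [Finset.sum_comm]
    refine Finset.sum_congr rfl fun j _ => Finset.sum_congr rfl fun i _ => ?_
    simp only [Algebra.smul_def, map_mul]
    ring
  refine (minTwice_iff _ _).2 fun a ha hne => ?_
  rw [Ne, WithTop.add_eq_top, not_or] at hne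
  simp only [hcoeff] at hne ⊢
  obtain ⟨j, hj, hjle⟩ : ∃ j, (h j).coeff a ≠ 0 ∧ v (b j) ≤ v (∑ j, (h j).coeff a • b j) := by
    by_contra hcon
    push Not at hcon
    refine lt_irrefl _ (v.map_lt_sum (s := Finset.univ) hne.1 fun j _ => ?_)
    by_cases hj : (h j).coeff a = 0
    · rw [hj, zero_smul, v.map_zero]
      exact lt_top_iff_ne_top.2 hne.1
    · exact (hcon j hj).trans_le (v.le_smul_of_trivial hv _ _)
  obtain ⟨a', ha', haa', hle⟩ := (minTwice_iff _ _).1 (hI _ (hhI j)) a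
    (MvPolynomial.mem_support_iff.2 hj) hne.2
  have h1 : v (∑ j, (h j).coeff a' • b j) ≤ v (b j) :=
    hb (fun j => (h j).coeff a') j (MvPolynomial.mem_support_iff.1 ha')
  refine ⟨a', ?_, haa', add_le_add (h1.trans hjle) hle⟩
  rw [MvPolynomial.mem_support_iff, hcoeff]
  exact v.ne_top_iff.1 (ne_top_of_le_ne_top (v.ne_top_iff.2 (hb0 j)) h1)

/-- Consequently the linear span over `K` of an ideal over `F` is already an ideal, and ideals
generated over `F` lie in such spans. -/
theorem mul_mem_span_map_image {F K σ : Type*} [Field F] [Field K] [Algebra F K]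
    {I : Ideal (MvPolynomial σ F)} (p : MvPolynomial σ K) {f : MvPolynomial σ K}
    (hf : f ∈ Submodule.span K (MvPolynomial.map (algebraMap F K) '' (I : Set (MvPolynomial σ F)))) :
    p * f ∈ Submodule.span K
      (MvPolynomial.map (algebraMap F K) '' (I : Set (MvPolynomial σ F))) := by
  induction p using MvPolynomial.induction_on generalizing f with
  | C a => rw [← MvPolynomial.smul_eq_C_mul]; exact Submodule.smul_mem _ _ hf
  | add p q hp hq => rw [add_mul]; exact Submodule.add_mem _ (hp hf) (hq hf)
  | mul_X p s hp =>
    rw [mul_assoc]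
    refine hp ?_
    induction hf using Submodule.span_induction with
    | mem x hx =>
      obtain ⟨g, hg, rfl⟩ := hx
      exact Submodule.subset_span ⟨MvPolynomial.X s * g, Ideal.mul_mem_left _ _ hg, by simp⟩
    | zero => simp
    | add x y _ _ hx hy => rw [mul_add]; exact Submodule.add_mem _ hx hy
    | smul c x _ hx => rw [mul_smul_comm]; exact Submodule.smul_mem _ _ hx

theorem map_pluckerVar {F K : Type*} [Field F] [Field K] (φ : F →+* K) {E : Type*} (k : ℕ)
    (J : Finset E) : MvPolynomial.map φ (pluckerVar F k J) = pluckerVar K k J := by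
  by_cases h : J.card = k <;> simp [pluckerVar, h]

theorem pluckerSymplecticIdeal_subset_span {F K : Type*} [Field F] [Field K] [Algebra F K] (k n : ℕ)
    {f : MvPolynomial {J : Finset (Fin n ⊕ Fin n) // J.card = k} K}
    (hf : f ∈ pluckerSymplecticIdeal K k n) :
    f ∈ Submodule.span K (MvPolynomial.map (algebraMap F K) ''
      (pluckerSymplecticIdeal F k n : Set (MvPolynomial _ F))) := by
  rw [pluckerSymplecticIdeal] at hf
  induction hf using Submodule.span_induction with
  | mem x hx =>
    refine Submodule.subset_span ?_
    rcases hx with ⟨S, T, hS, hT, rfl⟩ | ⟨S, hS, rfl⟩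
    · exact ⟨pluckerRelation F k n S T, Ideal.subset_span (Or.inl ⟨S, T, hS, hT, rfl⟩), by
        simp [pluckerRelation, map_pluckerVar]⟩
    · exact ⟨symplecticRelation F k n S, Ideal.subset_span (Or.inr ⟨S, hS, rfl⟩), by
        simp [symplecticRelation, map_pluckerVar]⟩
  | zero => exact Submodule.zero_mem _
  | add x y _ _ hx hy => exact Submodule.add_mem _ hx hy
  | smul p x _ hx => exact mul_mem_span_map_image p hx

theorem map_mem_pluckerSymplecticIdeal {F K : Type*} [Field F] [Field K] (φ : F →+* K) (k n : ℕ)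
    {f : MvPolynomial {J : Finset (Fin n ⊕ Fin n) // J.card = k} F}
    (hf : f ∈ pluckerSymplecticIdeal F k n) :
    MvPolynomial.map φ f ∈ pluckerSymplecticIdeal K k n := by
  suffices pluckerSymplecticIdeal F k n ≤
      (pluckerSymplecticIdeal K k n).comap (MvPolynomial.map φ) from this hf
  rw [pluckerSymplecticIdeal, Ideal.span_le]
  rintro f (⟨S, T, hS, hT, rfl⟩ | ⟨S, hS, rfl⟩)
  · have : MvPolynomial.map φ (pluckerRelation F k n S T) = pluckerRelation K k n S T := by
      simp [pluckerRelation, map_pluckerVar]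
    rw [SetLike.mem_coe, Ideal.mem_comap, this]
    exact Ideal.subset_span (Or.inl ⟨S, T, hS, hT, rfl⟩)
  · have : MvPolynomial.map φ (symplecticRelation F k n S) = symplecticRelation K k n S := by
      simp [symplecticRelation, map_pluckerVar]
    rw [SetLike.mem_coe, Ideal.mem_comap, this]
    exact Ideal.subset_span (Or.inr ⟨S, hS, rfl⟩)

/-- The tropical symplectic Grassmannian does not depend on the valued field, as long as the
valuation is trivial on a common subfield. -/
theorem mem_tropSymplecticGrOver_of_common_subfield {F K L : Type*} [Field F] [Field K] [Field L]
    [Algebra F K] [Algebra F L] (v : AddValuation K TropNum) (u : AddValuation L TropNum)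
    (hv : ∀ x : F, x ≠ 0 → v (algebraMap F K x) = 0)
    (hu : ∀ x : F, x ≠ 0 → u (algebraMap F L x) = 0) {k n : ℕ}
    {w : Finset (Fin n ⊕ Fin n) → TropNum} (hw : w ∈ tropSymplecticGrOver v k n) :
    w ∈ tropSymplecticGrOver u k n := by
  refine ⟨hw.1, fun f hf => inTropHypersurface_of_mem_span u hu (I := pluckerSymplecticIdeal F k n)
    (fun g hg => (minTwice_iff _ _).2 fun a ha hne => ?_) (pluckerSymplecticIdeal_subset_span k n hf)⟩
  -- A polynomial over `F` is tested in `K`, where its nonzero coefficients have valuation 0 and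
  -- only the weights by `w` remain.
  have h1 := hw.2 _ (map_mem_pluckerSymplecticIdeal (algebraMap F K) k n hg)
  rw [InTropHypersurface, minTwice_iff,
    MvPolynomial.support_map_of_injective _ (algebraMap F K).injective] at h1
  have h2 : ∀ a ∈ g.support, v ((MvPolynomial.map (algebraMap F K) g).coeff a) = 0 := fun a ha => by
    rw [MvPolynomial.coeff_map, hv _ (MvPolynomial.mem_support_iff.1 ha)]
  obtain ⟨a', ha', haa', hle⟩ := h1 a ha (by rwa [h2 a ha, zero_add])
  refine ⟨a', ha', haa', ?_⟩
  rwa [h2 a ha, h2 a' ha', zero_add, zero_add] at hle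

/-- `hF` expresses that `F` is a prime field, all of whose elements are quotients of integers. -/
theorem TrivialOnPrimeField.map_algebraMap {F K : Type*} [Field F] [Field K] [Algebra F K]
    {v : AddValuation K TropNum} (hv : TrivialOnPrimeField v)
    (hF : ∀ x : F, ∃ a b : ℤ, (b : F) ≠ 0 ∧ x * b = a) {x : F} (hx : x ≠ 0) :
    v (algebraMap F K x) = 0 := by
  obtain ⟨a, b, hb, hab⟩ := hF x
  have hint : ∀ m : ℤ, (m : F) ≠ 0 → v (m : K) = 0 := fun m hm => hv m (by
    rw [← map_intCast (algebraMap F K)]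
    exact (map_ne_zero _).2 hm)
  have h1 := congrArg (fun y => v (algebraMap F K y)) hab
  simp only [map_mul, map_intCast, v.map_mul, hint b hb, add_zero] at h1
  rw [h1, hint a (hab ▸ mul_ne_zero hx hb)]

theorem mem_tropSymplecticGr_of_mem_tropSymplecticGrOver {K : Type u} [Field K] (p : ℕ) [CharP K p]
    {v : AddValuation K TropNum} (hv : TrivialOnPrimeField v) {k n : ℕ}
    {w : Finset (Fin n ⊕ Fin n) → TropNum} (hw : w ∈ tropSymplecticGrOver v k n) :
    w ∈ tropSymplecticGr.{w} p k n := by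
  intro L _ _ _ u hu
  rcases CharP.char_is_prime_or_zero K p with hp | rfl
  · have : Fact p.Prime := ⟨hp⟩
    let _ : Algebra (ZMod p) K := ZMod.algebra K p
    let _ : Algebra (ZMod p) L := ZMod.algebra L p
    have hF : ∀ x : ZMod p, ∃ a b : ℤ, (b : ZMod p) ≠ 0 ∧ x * b = a := fun x =>
      ⟨x.val, 1, by simp, by simp⟩
    exact mem_tropSymplecticGrOver_of_common_subfield (F := ZMod p) v u
      (fun _ => hv.map_algebraMap hF) (fun _ => hu.map_algebraMap hF) hw
  · have : CharZero K := CharP.charP_to_charZero K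
    have : CharZero L := CharP.charP_to_charZero L
    have hF : ∀ x : ℚ, ∃ a b : ℤ, (b : ℚ) ≠ 0 ∧ x * b = a := fun x =>
      ⟨x.num, x.den, by simp, by simp [Rat.mul_den_eq_num]⟩
    exact mem_tropSymplecticGrOver_of_common_subfield (F := ℚ) v u
      (fun _ => hv.map_algebraMap hF) (fun _ => hu.map_algebraMap hF) hw

theorem theorem8p2 (n k : ℕ) (μ : Finset (Fin n) → TropNum)
    (hμ : IsValuatedMatroid k μ) :
    (∀ (p : ℕ) (K : Type u) [Field K] [CharP K p] (v : AddValuation K TropNum),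
      IsRealizableVM v k μ →
        directSumVM μ (dualVM μ) ∈ tropSymplecticGrOver v n n ∧
        (TrivialOnPrimeField v →
          directSumVM μ (dualVM μ) ∈ tropSymplecticGr.{w} p n n)) ∧
    directSumVM μ (dualVM μ) ∈ symplecticDressian n n ∧
    TropIsotropic (conormalBundle μ) ∧
    (IsTransversalVM k μ → IsTransversalVM (n - k) (dualVM μ) →
      (HasSymmetricPresentation n (directSumVM μ (dualVM μ)) ↔ ∃! B, μ B ≠ ⊤)) := by
  refine ⟨fun p K _ _ v h => ?_, directSumVM_dualVM_mem_symplecticDressian hμ,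
    conormalBundle_isotropic hμ.1, fun _ _ =>
      ⟨existsUnique_basis_of_hasSymmetricPresentation hμ.1,
        hasSymmetricPresentation_of_existsUnique_basis⟩⟩
  have hmem := directSumVM_dualVM_mem_tropSymplecticGrOver hμ.1 v h
  exact ⟨hmem, fun hv => mem_tropSymplecticGr_of_mem_tropSymplecticGrOver p hv hmem⟩
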